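/- Let $n,d\in\mathbb N$, let $m_1,\dots,m_n>0$ be masses, and let $M=\{q\in(\mathbb R^d)^n : \sum_k m_kq_k=0\}$ be the center of mass configuration space, with the Euclidean norm $\|\cdot\|$ of $\mathbb R^{nd}$. For $q\in M$ let $\mathrm{CS}(q)$ be the set partition of $\{1,\dots,n\}$ in which $i,j$ belong to the same cluster iff $q_i=q_j$. For a set partition $\mathcal C$ let $q^E_{\mathcal C}$ be obtained from $q$ by replacing each $q_i$ by the barycenter $\big(\sum_{j\in C}m_j\big)^{-1}\sum_{j\in C}m_jq_j$ of the cluster $C\in\mathcal C$ containing $i$. For a curve $q$ in $M$ on an interval $I$ we write $\mathrm{CS}(t)=\mathrm{CS}(q(t))$; the collision times of $q$ are the $t\in I$ at which $\mathrm{CS}:I\to\mathcal P(\{1,\dots,n\})$ is not locally constant. A nondeterministic trajectory is a continuous curve $q:(T^-,T^+)\to M$, with $-\infty\le T^-<0<T^+\le\infty$, such that 1. if $T^+$ (resp. $T^-$) is finite, then $q(t)$ has no limit in $M$ as $t\nearrow T^+$ (resp. $t\searrow T^-$); 2. on each interval that contains no collision times, the momentum $(m_1q_1',\dots,m_nq_n')$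 exists and is constant; 3. for every $\tau\in(T^-,T^+)$, the curve $t\mapsto q^E_{\mathrm{CS}(\tau)}(t)$ is continuously differentiable on an open interval containing $\tau$, and its momentum $\big(m_i\,\tfrac{d}{dt}(q^E_{\mathrm{CS}(\tau)})_i\big)_{i}$ is constant near $\tau$. A nondeterministic forward trajectory $q:[0,T)\to M$ is the restriction to $[0,T)$ of a nondeterministic trajectory with $T^+=T$. **Proposition.** For every nondeterministic forward trajectory $q:[0,T)\to M$ there is a family $(q^{(\varepsilon)})_{\varepsilon>0}$ of nondeterministic forward trajectories $q^{(\varepsilon)}:[0,T)\to M$ such that - for every compact set $K\subseteq[0,T)$, $\displaystyle\lim_{\varepsilon\downarrow0}\ \sup_{t\in K}\big\|q^{(\varepsilon)}(t)-q(t)\big\|=0$; - for every $\varepsilon>0$ and every compact set $K\subseteq[0,T)$, the curve $q^{(\varepsilon)}$ has only finitely many collision times in $K$. -/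

import Mathlib

open Filter Topology

namespace NDParticles

/-- Positions of `n` particles in `ℝ^d`, that is, points of `ℝ^{nd}`. The topology and the
differentiable structure are the usual ones; the Euclidean norm is `euclNorm` below. -/
abbrev Config (n d : ℕ) : Type := Fin n → EuclideanSpace ℝ (Fin d)

variable {n d : ℕ}

/-- The Euclidean norm of `ℝ^{nd}`. -/
noncomputable def euclNorm (q : Config n d) : ℝ := √(∑ i, ‖q i‖ ^ 2)

/-- Multiplication by the mass matrix `diag(m_1, …, m_n) ⊗ 1`. -/
def massMul (m : Fin n → ℝ) (v : Config n d) : Config n d :=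
  fun i => m i • v i

/-- The center of mass configuration space `M`. -/
def comSpace (d : ℕ) (m : Fin n → ℝ) : Submodule ℝ (Config n d) where
  carrier := {q | ∑ k, m k • q k = 0}
  add_mem' := by
    intro a b ha hb
    simp only [Set.mem_ofPred_eq] at ha hb ⊢
    simp [smul_add, Finset.sum_add_distrib, ha, hb]
  zero_mem' := by simp
  smul_mem' := by
    intro c x hx
    simp only [Set.mem_ofPred_eq] at hx ⊢
    simp only [Pi.smul_apply, smul_comm _ c, ← Finset.smul_sum, hx, smul_zero]

/- Set partitions of `{1, …, n}` are equivalence relations on `Fin n`;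
`C ≤ D` in `Setoid (Fin n)` means that `C` is finer than `D`. -/

/-- The collision subspace `Δ_C` of a set partition `C`. -/
def collisionSubspace (m : Fin n → ℝ) (C : Setoid (Fin n)) : Set (Config n d) :=
  {q | q ∈ comSpace d m ∧ ∀ i j, C i j → q i = q j}

/-- The atom `Ξ_C`: the part of `Δ_C` in no `Δ_D` with `D` strictly coarser than `C`. -/
def collisionAtom (m : Fin n → ℝ) (C : Setoid (Fin n)) : Set (Config n d) :=
  collisionSubspace m C \ ⋃ D ∈ {D : Setoid (Fin n) | C < D}, collisionSubspace m D

/-- The collision set of a configuration: `i` and `j` are in the same cluster iff they are at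
the same position. By `mem_collisionAtom_iff` it is the `C` with `q ∈ Ξ_C`. -/
def collisionSet (q : Config n d) : Setoid (Fin n) := Setoid.ker fun i => q i

theorem mem_collisionAtom_iff (m : Fin n → ℝ) (C : Setoid (Fin n)) {q : Config n d}
    (hq : q ∈ comSpace d m) : q ∈ collisionAtom m C ↔ C = collisionSet q := by
  constructor
  · rintro ⟨⟨_, h1⟩, h2⟩
    have hle : C ≤ collisionSet q := fun {i j} hij => h1 i j hij
    by_contra hne
    refine h2 (Set.mem_biUnion (x := collisionSet q) (lt_of_le_of_ne hle hne) ⟨hq, ?_⟩)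
    exact fun i j hij => hij
  · rintro rfl
    refine ⟨⟨hq, fun i j hij => hij⟩, fun h => ?_⟩
    obtain ⟨D, hD, _, hDq⟩ := Set.mem_iUnion₂.1 h
    exact not_le_of_gt (show collisionSet q < D from hD) fun {i j} hij => hDq i j hij

open Classical in
/-- The cluster projection `q ↦ q^E_C`: particle `i` is put at the barycenter of its cluster.
For positive masses it is the orthogonal projection to the configurations that are constant on
clusters, with respect to the inner product given by the masses. -/
noncomputable def extProj (m : Fin n → ℝ) (C : Setoid (Fin n)) (q : Config n d) : Config n d :=
  fun i =>
    (∑ j with C i j, m j)⁻¹ • ∑ j with C i j, m j • q j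

/-- The collision times of the curve `q` on the interval `I`: the times in `I` at which the
collision set is not locally constant. -/
def collisionTimes (I : Set ℝ) (q : ℝ → Config n d) : Set ℝ :=
  {t | t ∈ I ∧ ¬ ∀ᶠ s in 𝓝[I] t, collisionSet (q s) = collisionSet (q t)}

/-- The open time interval `(a, b)` with end points in `[-∞, ∞]`. -/
def openInterval (a b : EReal) : Set ℝ := {t | a < (t : EReal) ∧ (t : EReal) < b}

/-- The time interval `[0, b)` with `b ∈ [-∞, ∞]`. -/
def forwardInterval (b : EReal) : Set ℝ := {t | 0 ≤ t ∧ (t : EReal) < b}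

/-- `q` is, on `(Tm, Tp)`, a nondeterministic trajectory of particles with masses `m`, with
escape times `Tm` and `Tp`. The values of `q` outside of `(Tm, Tp)` are irrelevant. -/
structure IsTrajectory (m : Fin n → ℝ) (Tm Tp : EReal) (q : ℝ → Config n d) : Prop where
  Tm_neg : Tm < 0
  Tp_pos : 0 < Tp
  mem : ∀ t ∈ openInterval Tm Tp, q t ∈ comSpace d m
  continuousOn : ContinuousOn q (openInterval Tm Tp)
  /-- If `Tm` is finite, then `q` has no limit there. -/
  no_limit_Tm : ∀ a : ℝ, Tm = (a : EReal) → ¬ ∃ x ∈ comSpace d m, Tendsto q (𝓝[>] a) (𝓝 x)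
  /-- If `Tp` is finite, then `q` has no limit there. -/
  no_limit_Tp : ∀ b : ℝ, Tp = (b : EReal) → ¬ ∃ x ∈ comSpace d m, Tendsto q (𝓝[<] b) (𝓝 x)
  /-- The momentum exists and is constant on each interval without collision times. -/
  momentum_const : ∀ J : Set ℝ, J.OrdConnected →
    J ⊆ openInterval Tm Tp \ collisionTimes (openInterval Tm Tp) q →
    ∃ p : Config n d, ∀ t ∈ J, ∃ v : Config n d, HasDerivAt q v t ∧ massMul m v = p
  /-- Near each time `τ`, the barycenters of the clusters at time `τ` move in a continuously
  differentiable way, and their momenta are locally constant at `τ`. -/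
  external : ∀ τ ∈ openInterval Tm Tp, ∃ a b : ℝ, a < τ ∧ τ < b ∧
    Set.Ioo a b ⊆ openInterval Tm Tp ∧
    ContDiffOn ℝ 1 (fun t => extProj m (collisionSet (q τ)) (q t)) (Set.Ioo a b) ∧
    ∀ᶠ t in 𝓝 τ,
      massMul m (deriv (fun s => extProj m (collisionSet (q τ)) (q s)) t) =
        massMul m (deriv (fun s => extProj m (collisionSet (q τ)) (q s)) τ)

/-- `q` is, on `[0, T)`, a nondeterministic forward trajectory: the restriction to `[0, T)` of
a nondeterministic trajectory with upper escape time `T`. -/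
def IsForwardTrajectory (m : Fin n → ℝ) (T : EReal) (q : ℝ → Config n d) : Prop :=
  ∃ (Tm : EReal) (r : ℝ → Config n d),
    IsTrajectory m Tm T r ∧ Set.EqOn q r (forwardInterval T)

end NDParticles

/-! In the mass metric let `V t` be the collision subspace of the clusters of the given trajectory
at time `t`. Near each `τ` clusters can only split, so `V τ ≤ V s` for `s` near `τ`, and the
projection of the trajectory to `V τ` moves in a straight line there.

The approximation `u` is an elastic string in equilibrium: at a locally finite set `S` of times it
is held in `V σ`; between these times it is straight, and its kink at `σ` is orthogonal to `V σ`.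
Particles that meet in the given trajectory at `σ ∈ S` also meet in `u`, so this orthogonality gives
momentum conservation for every cluster of `u`. On a bounded interval such strings exist for any
choice of finitely many constraints (`exists_kinks`, `exists_isNetwork`).

The point is that sufficiently dense constraints force `u` to stay close. For a positive, strictly
concave `ψ` and `c ≥ 1`, the bound `‖u - q‖² ≤ c ψ` becomes strict near a constraint time `τ`
(`exists_gauge`). Indeed the part of `u - q` in `V τ` is affine, the orthogonal part is small near
`τ` (for `u` by convexity, for `q` by continuity), and the strict concavity of `ψ` absorbs this
error. The size of this neighborhood depends only on `τ`, so `S` can be chosen afterwards such that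
the neighborhoods cover `[0, T)`. The optimal `c` is then less than `1` (`le_of_forall_improve`). A
compactness argument passes from bounded intervals to `[0, T)` (`exists_isNetwork_near`).

Taking `ψ = ε φ` with `φ` bounded gives convergence. If `T` is finite, `φ` tends to `0` there, so
`u` inherits the lack of a limit at `T`. -/

namespace NDParticles

variable {n d : ℕ}

/-! ### Existence of equilibria with finitely many constraints -/

section Network

variable {E : Type*} [NormedAddCommGroup E] [InnerProductSpace ℝ E]

/-- The kernel `(σ, ρ) ↦ min σ ρ - a` is strictly positive definite on `(a, ∞)`. -/
theorem sum_min_sub_mul_inner_nonneg (S : Finset ℝ) (c : ℝ → E) : ∀ a : ℝ, (∀ σ ∈ S, a < σ) →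
    0 ≤ ∑ σ ∈ S, ∑ ρ ∈ S, (min σ ρ - a) * inner ℝ (c σ) (c ρ) ∧
    (∑ σ ∈ S, ∑ ρ ∈ S, (min σ ρ - a) * inner ℝ (c σ) (c ρ) = 0 → ∀ σ ∈ S, c σ = 0) := by
  induction S using Finset.induction_on_min with
  | empty => simp
  | insert a₀ S h ih =>
    intro a ha
    have ha₀ : a₀ ∉ S := fun h' => lt_irrefl _ (h _ h')
    -- The least time `a₀` splits off a square, since `min σ ρ - a = (a₀ - a) + (min σ ρ - a₀)` and
    -- the second summand vanishes when `σ` or `ρ` is `a₀`.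
    have key : ∑ σ ∈ insert a₀ S, ∑ ρ ∈ insert a₀ S, (min σ ρ - a) * inner ℝ (c σ) (c ρ) =
        (a₀ - a) * ‖∑ σ ∈ insert a₀ S, c σ‖ ^ 2 +
          ∑ σ ∈ S, ∑ ρ ∈ S, (min σ ρ - a₀) * inner ℝ (c σ) (c ρ) := by
      have h1 : ∑ σ ∈ insert a₀ S, ∑ ρ ∈ insert a₀ S, (min σ ρ - a) * inner ℝ (c σ) (c ρ) =
          ∑ σ ∈ insert a₀ S, ∑ ρ ∈ insert a₀ S, (a₀ - a) * inner ℝ (c σ) (c ρ) +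
          ∑ σ ∈ insert a₀ S, ∑ ρ ∈ insert a₀ S, (min σ ρ - a₀) * inner ℝ (c σ) (c ρ) := by
        simp only [← Finset.sum_add_distrib]
        refine Finset.sum_congr rfl fun σ _ => Finset.sum_congr rfl fun ρ _ => by ring
      rw [h1]
      congr 1
      · rw [← real_inner_self_eq_norm_sq, sum_inner, Finset.mul_sum]
        simp only [inner_sum, Finset.mul_sum]
      · rw [Finset.sum_insert ha₀]
        have h2 : ∀ ρ ∈ insert a₀ S, (min a₀ ρ - a₀) * inner ℝ (c a₀) (c ρ) = 0 := by
          intro ρ hρ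
          rcases Finset.mem_insert.1 hρ with rfl | hρ
          · simp
          · simp [min_eq_left (h ρ hρ).le]
        rw [Finset.sum_eq_zero h2, zero_add]
        refine Finset.sum_congr rfl fun σ hσ => ?_
        rw [Finset.sum_insert ha₀, min_eq_right (h σ hσ).le]
        simp
    obtain ⟨ih1, ih2⟩ := ih a₀ h
    have hpos : 0 < a₀ - a := sub_pos.2 (ha _ (Finset.mem_insert_self _ _))
    have hsq := mul_nonneg hpos.le (sq_nonneg ‖∑ σ ∈ insert a₀ S, c σ‖)
    rw [key]
    refine ⟨by linarith, fun h0 => ?_⟩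
    have hS := ih2 (by linarith)
    have h3 : (a₀ - a) * ‖∑ σ ∈ insert a₀ S, c σ‖ ^ 2 = 0 := by linarith
    have h4 : ∑ σ ∈ insert a₀ S, c σ = 0 := by
      simpa [hpos.ne'] using h3
    rw [Finset.sum_insert ha₀, Finset.sum_eq_zero hS, add_zero] at h4
    intro σ hσ
    rcases Finset.mem_insert.1 hσ with rfl | hσ
    · exact h4
    · exact hS σ hσ

/-- There is a piecewise linear curve `t ↦ ∑ ρ ∈ S, min t ρ • c ρ` whose kink at `σ ∈ S` is
orthogonal to `V σ` and which at time `σ` agrees with `z` modulo `V σ`. -/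
theorem exists_kinks [FiniteDimensional ℝ E] (S : Finset ℝ) (hS : ∀ σ ∈ S, 0 < σ)
    (V : ℝ → Submodule ℝ E) (z : ℝ → E) :
    ∃ c : ℝ → E, (∀ σ ∈ S, c σ ∈ (V σ)ᗮ) ∧ ∀ σ ∈ S, ∑ ρ ∈ S, min σ ρ • c ρ - z σ ∈ V σ := by
  let ext : (S → E) → ℝ → E := fun c t => if h : t ∈ S then c ⟨t, h⟩ else 0
  have hext : ∀ (c : S → E) (σ : ℝ), ∑ ρ : S, min σ (ρ : ℝ) • c ρ =
      ∑ ρ ∈ S, min σ ρ • ext c ρ := by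
    intro c σ
    rw [← Finset.sum_coe_sort S]
    refine Finset.sum_congr rfl fun ρ _ => ?_
    simp [ext]
  -- Both requirements at `σ` form one equation in `E`, one in `V σ` and one in its complement. The
  -- system is therefore square, and injectivity suffices.
  let L : (S → E) →ₗ[ℝ] (S → E) := LinearMap.pi fun σ =>
    (V σ).starProjection.toLinearMap ∘ₗ LinearMap.proj σ +
      (V σ)ᗮ.starProjection.toLinearMap ∘ₗ
        ∑ ρ : S, min (σ : ℝ) (ρ : ℝ) • (LinearMap.proj ρ : (S → E) →ₗ[ℝ] E)
  have hL : ∀ c σ, L c σ = (V σ).starProjection (c σ) +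
      (V σ)ᗮ.starProjection (∑ ρ ∈ S, min (σ : ℝ) ρ • ext c ρ) := by
    intro c σ
    rw [← hext]
    simp [L, LinearMap.pi_apply]
  have split : ∀ (K : Submodule ℝ E) (x y z : E),
      K.starProjection x + Kᗮ.starProjection y = Kᗮ.starProjection z →
      x ∈ Kᗮ ∧ y - z ∈ K := by
    intro K x y z h
    have h1 : K.starProjection x = Kᗮ.starProjection (z - y) := by
      rw [map_sub, ← h]; abel
    have h2 : K.starProjection x = 0 := by
      have ha : K.starProjection x ∈ K := K.starProjection_apply_mem x
      have hb : K.starProjection x ∈ Kᗮ := h1 ▸ Kᗮ.starProjection_apply_mem _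
      have := (Submodule.mem_orthogonal K _).1 hb _ ha
      exact inner_self_eq_zero.1 this
    refine ⟨by rwa [Submodule.starProjection_apply_eq_zero_iff] at h2, ?_⟩
    rw [h2] at h1
    have h3 := (Submodule.starProjection_apply_eq_zero_iff _).1 h1.symm
    rw [Submodule.orthogonal_orthogonal] at h3
    simpa using K.neg_mem h3
  have hinj : Function.Injective L := by
    rw [← LinearMap.ker_eq_bot, LinearMap.ker_eq_bot']
    intro c hc
    have h1 : ∀ σ : S, c σ ∈ (V σ)ᗮ ∧ ∑ ρ ∈ S, min (σ : ℝ) ρ • ext c ρ ∈ V σ := by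
      intro σ
      have := split (V σ) (c σ) (∑ ρ ∈ S, min (σ : ℝ) ρ • ext c ρ) 0 (by
        rw [← hL, hc]; simp)
      simpa using this
    -- For a homogeneous solution the kink at `σ` is orthogonal to the position at `σ`; summing over
    -- `σ` makes the quadratic form vanish.
    have h2 := (sum_min_sub_mul_inner_nonneg S (ext c) 0 hS).2 (by
      refine Finset.sum_eq_zero fun σ hσ => ?_
      have h3 := (Submodule.mem_orthogonal' _ _).1 (h1 ⟨σ, hσ⟩).1 _ (h1 ⟨σ, hσ⟩).2
      rw [inner_sum] at h3
      refine Eq.trans (Finset.sum_congr rfl fun ρ _ => ?_) h3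
      rw [inner_smul_right, sub_zero]
      simp [ext, hσ])
    ext1 σ
    simpa [ext] using h2 σ σ.2
  obtain ⟨c, hc⟩ := (LinearMap.injective_iff_surjective.1 hinj)
    (fun σ => (V σ)ᗮ.starProjection (z σ))
  have h := fun σ : S => split (V σ) (c σ) _ _ ((hL c σ).symm.trans (congrFun hc σ))
  refine ⟨ext c, fun σ hσ => ?_, fun σ hσ => (h ⟨σ, hσ⟩).2⟩
  simpa [ext, hσ] using (h ⟨σ, hσ⟩).1

/-- The curve `u` is, on `[0, B]`, an equilibrium of the network with constraints `V σ` at the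
times `σ ∈ S`: `u σ ∈ V σ`, and `u` is piecewise linear with kinks at the times in `S` only,
the kink at `σ` being orthogonal to `V σ`. The latter is expressed weakly: a component of `u`
in a direction that is allowed by all constraints in `(s, t)` is affine on `[s, t]`. -/
structure IsNetwork (S : Set ℝ) (V : ℝ → Submodule ℝ E) (B : ℝ) (u : ℝ → E) : Prop where
  mem : ∀ σ ∈ S, 0 ≤ σ → σ ≤ B → u σ ∈ V σ
  chord : ∀ s x t, 0 ≤ s → s ≤ x → x ≤ t → t ≤ B →
    ∀ v, (∀ σ ∈ S, s < σ → σ < t → v ∈ V σ) →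
      (t - s) * inner ℝ (u x) v = (t - x) * inner ℝ (u s) v + (x - s) * inner ℝ (u t) v

theorem exists_isNetwork [FiniteDimensional ℝ E] (S : Set ℝ) (V : ℝ → Submodule ℝ E) {B : ℝ}
    (hB : 0 < B) (hS : (S ∩ Set.Icc 0 B).Finite) (q : ℝ → E)
    (hq : ∀ t ∈ Set.Icc 0 B, q t ∈ V t) :
    ∃ u, Continuous u ∧ IsNetwork S V B u ∧ u 0 = q 0 ∧ u B = q B := by
  classical
  have hfin : (S ∩ Set.Ioo 0 B).Finite :=
    hS.subset (Set.inter_subset_inter_right _ Set.Ioo_subset_Icc_self)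
  set F : Finset ℝ := insert B hfin.toFinset with hF
  have hFmem : ∀ σ, σ ∈ F ↔ σ = B ∨ (σ ∈ S ∧ 0 < σ ∧ σ < B) := by
    intro σ
    simp [hF]
  -- The constraint `⊥` at `B` prescribes the end point exactly; the kink there is arbitrary and
  -- lies outside the open time interval.
  let V' : ℝ → Submodule ℝ E := fun t => if t = B then ⊥ else V t
  have hF0 : ∀ σ ∈ F, 0 < σ := by
    intro σ hσ
    rcases (hFmem σ).1 hσ with rfl | h
    · exact hB
    · exact h.2.1
  obtain ⟨c, hc1, hc2⟩ := exists_kinks F hF0 V' (fun t => q t - q 0)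
  refine ⟨fun t => q 0 + ∑ ρ ∈ F, min t ρ • c ρ, by fun_prop, ?_, ?_, ?_⟩
  · have hend : q 0 + ∑ ρ ∈ F, min B ρ • c ρ = q B := by
      have := hc2 B ((hFmem B).2 (Or.inl rfl))
      simp only [V', if_true, Submodule.mem_bot] at this
      rw [sub_eq_zero.1 this]; abel
    have hstart : q 0 + ∑ ρ ∈ F, min 0 ρ • c ρ = q 0 := by
      rw [Finset.sum_eq_zero, add_zero]
      intro ρ hρ
      rw [min_eq_left (hF0 ρ hρ).le, zero_smul]
    refine ⟨fun σ hσ h0 hσB => ?_, fun s x t h0 hsx hxt htB v hv => ?_⟩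
    · rcases h0.eq_or_lt with rfl | h0
      · rw [hstart]; exact hq 0 ⟨le_rfl, hB.le⟩
      · rcases hσB.eq_or_lt with rfl | hσB
        · rw [hend]; exact hq σ ⟨h0.le, le_rfl⟩
        · have := hc2 σ ((hFmem σ).2 (Or.inr ⟨hσ, h0, hσB⟩))
          simp only [V', if_neg hσB.ne] at this
          have h2 := (V σ).add_mem this (hq σ ⟨h0.le, hσB.le⟩)
          convert h2 using 1
          abel
    · simp only [inner_add_left, sum_inner, real_inner_smul_left, mul_add, Finset.mul_sum]
      have : ∀ ρ ∈ F, (t - s) * (min x ρ * inner ℝ (c ρ) v) =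
          (t - x) * (min s ρ * inner ℝ (c ρ) v) + (x - s) * (min t ρ * inner ℝ (c ρ) v) := by
        intro ρ hρ
        by_cases h1 : s < ρ
        · by_cases h2 : ρ < t
          · rcases (hFmem ρ).1 hρ with rfl | h
            · exact absurd h2 (not_lt.2 htB)
            · have := hc1 ρ hρ
              simp only [V', if_neg h.2.2.ne] at this
              rw [(Submodule.mem_orthogonal' _ _).1 this _ (hv ρ h.1 h1 h2)]
              ring
          · rw [not_lt] at h2
            rw [min_eq_left h2, min_eq_left (hxt.trans h2), min_eq_left h1.le]
            ring
        · rw [not_lt] at h1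
          rw [min_eq_right h1, min_eq_right (h1.trans hsx),
            min_eq_right (h1.trans (hsx.trans hxt))]
          ring
      rw [Finset.sum_congr rfl this, Finset.sum_add_distrib]
      ring
  · simp only
    rw [Finset.sum_eq_zero, add_zero]
    intro ρ hρ
    rw [min_eq_left (hF0 ρ hρ).le, zero_smul]
  · have := hc2 B ((hFmem B).2 (Or.inl rfl))
    simp only [V', if_true, Submodule.mem_bot] at this
    simp only
    rw [sub_eq_zero.1 this]; abel

end Network

/-! ### Convexity estimates for equilibria -/

/-- A continuous function that lies locally below its chords lies below its chord. -/
theorem le_chord_of_local {g : ℝ → ℝ} {s t : ℝ} (hst : s < t)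
    (hg : ContinuousOn g (Set.Icc s t))
    (hloc : ∀ x ∈ Set.Ioo s t, ∃ δ > 0, ∀ s' t', x - δ < s' → s' < x → x < t' → t' < x + δ →
      s ≤ s' → t' ≤ t → (t' - s') * g x ≤ (t' - x) * g s' + (x - s') * g t') :
    ∀ x ∈ Set.Icc s t, (t - s) * g x ≤ (t - x) * g s + (x - s) * g t := by
  intro x hx
  by_contra! hcon
  set h : ℝ → ℝ := fun y => (t - s) * g y - (t - y) * g s - (y - s) * g t with hh
  have hhc : ContinuousOn h (Set.Icc s t) := by fun_prop
  obtain ⟨z, hz, hzmax⟩ := isCompact_Icc.exists_isMaxOn ⟨x, hx⟩ hhc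
  have hpos : 0 < h z := lt_of_lt_of_le (by simp only [hh]; linarith) (hzmax hx)
  have hA : IsCompact (Set.Icc s t ∩ h ⁻¹' {h z}) :=
    isCompact_Icc.of_isClosed_subset (hhc.preimage_isClosed_of_isClosed isClosed_Icc
      isClosed_singleton) Set.inter_subset_left
  -- At the leftmost maximum, values to the left are strictly smaller, which contradicts the local
  -- chord inequality.
  obtain ⟨y, ⟨hy, hyz⟩, hleast⟩ := hA.exists_isLeast ⟨z, hz, rfl⟩
  replace hyz : h y = h z := hyz
  have hsy : s < y := by
    refine lt_of_le_of_ne hy.1 ?_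
    rintro rfl
    have : h s = 0 := by simp only [hh]; ring
    linarith
  have hyt : y < t := by
    refine lt_of_le_of_ne hy.2 ?_
    rintro rfl
    have : h y = 0 := by simp only [hh]; ring
    linarith
  obtain ⟨δ, hδ, H⟩ := hloc y ⟨hsy, hyt⟩
  obtain ⟨s', hs1, hs2⟩ := exists_between (max_lt hsy (by linarith : y - δ < y))
  obtain ⟨t', ht1, ht2⟩ := exists_between (lt_min hyt (by linarith : y < y + δ))
  rw [max_lt_iff] at hs1
  rw [lt_min_iff] at ht2
  have h1 := H s' t' hs1.2 hs2 ht1 ht2.2 hs1.1.le ht2.1.le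
  have hs'mem : s' ∈ Set.Icc s t := ⟨hs1.1.le, by linarith⟩
  have ht'mem : t' ∈ Set.Icc s t := ⟨by linarith, ht2.1.le⟩
  have h2 : h s' < h z := by
    refine lt_of_le_of_ne (hzmax hs'mem) fun he => ?_
    exact absurd (hleast ⟨hs'mem, he⟩) (not_le.2 hs2)
  have h3 : h t' ≤ h z := hzmax ht'mem
  have h4 : (t' - s') * h y ≤ (t' - y) * h s' + (y - s') * h t' := by
    have := mul_le_mul_of_nonneg_left h1 (sub_pos.2 hst).le
    simp only [hh]
    linear_combination this
  have h5 := mul_lt_mul_of_pos_left h2 (sub_pos.2 ht1)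
  have h6 := mul_le_mul_of_nonneg_left h3 (sub_pos.2 hs2).le
  rw [hyz] at h4
  linarith

section Network

variable {E : Type*} [NormedAddCommGroup E] [InnerProductSpace ℝ E] [FiniteDimensional ℝ E]
  {S : Set ℝ} {V : ℝ → Submodule ℝ E} {B : ℝ} {u q : ℝ → E} {ψ : ℝ → ℝ}

theorem IsNetwork.starProjection_chord (hu : IsNetwork S V B u) (W : Submodule ℝ E) {s x t : ℝ}
    (hs : 0 ≤ s) (hsx : s ≤ x) (hxt : x ≤ t) (ht : t ≤ B)
    (hW : ∀ σ ∈ S, s < σ → σ < t → W ≤ V σ) :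
    (t - s) • W.starProjection (u x) =
      (t - x) • W.starProjection (u s) + (x - s) • W.starProjection (u t) := by
  refine ext_inner_right ℝ fun v => ?_
  have h := hu.chord s x t hs hsx hxt ht (W.starProjection v) fun σ hσ h1 h2 =>
    hW σ hσ h1 h2 (W.starProjection_apply_mem v)
  simpa only [inner_add_left, real_inner_smul_left, Submodule.inner_starProjection_left_eq_right]
    using h

/-- The distance from `u` to `W` is convex: a kink at `x` is orthogonal to `V x`, hence to the
component `e` of `u x` normal to `W`. Testing the chord identity with `e` and Cauchy–Schwarz give
the local inequality. -/
theorem IsNetwork.norm_sub_starProjection_le (hu : IsNetwork S V B u)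
    (huc : ContinuousOn u (Set.Icc 0 B))
    (hS : ∀ t ∈ Set.Icc 0 B, ∃ δ > 0, ∀ σ ∈ S, |σ - t| < δ → σ = t)
    (W : Submodule ℝ E) {s t : ℝ} (hs : 0 ≤ s) (hst : s < t) (ht : t ≤ B)
    (hW : ∀ σ ∈ S, s < σ → σ < t → W ≤ V σ) :
    ∀ x ∈ Set.Icc s t, (t - s) * ‖u x - W.starProjection (u x)‖ ≤
      (t - x) * ‖u s - W.starProjection (u s)‖ + (x - s) * ‖u t - W.starProjection (u t)‖ := by
  have hc : ContinuousOn u (Set.Icc s t) := huc.mono (Set.Icc_subset_Icc hs ht)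
  refine le_chord_of_local (g := fun x => ‖u x - W.starProjection (u x)‖) hst ?_ ?_
  · exact (hc.sub (W.starProjection.continuous.comp_continuousOn hc)).norm
  intro x hx
  obtain ⟨δ, hδ, hδS⟩ := hS x ⟨hs.trans hx.1.le, hx.2.le.trans ht⟩
  refine ⟨δ, hδ, fun s' t' h1 h2 h3 h4 h5 h6 => ?_⟩
  set e := u x - W.starProjection (u x) with he
  have heW : e ∈ Wᗮ := W.sub_starProjection_mem_orthogonal _
  have hin : ∀ y, inner ℝ (u y) e = inner ℝ (u y - W.starProjection (u y)) e := by
    intro y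
    rw [inner_sub_left, (Submodule.mem_orthogonal _ _).1 heW _ (W.starProjection_apply_mem _),
      sub_zero]
  have hch := hu.chord s' x t' (hs.trans h5) h2.le h3.le (h6.trans ht) e (by
    intro σ hσ h7 h8
    have hσx : σ = x := hδS σ hσ (abs_lt.2 ⟨by linarith, by linarith⟩)
    subst hσx
    exact (V σ).sub_mem (hu.mem σ hσ (by linarith) (by linarith))
      (hW σ hσ hx.1 hx.2 (W.starProjection_apply_mem _)))
  rw [hin x, hin s', hin t', ← he, real_inner_self_eq_norm_sq] at hch
  have hl := mul_le_mul_of_nonneg_left (real_inner_le_norm (u s' - W.starProjection (u s')) e)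
    (sub_pos.2 h3).le
  have hr := mul_le_mul_of_nonneg_left (real_inner_le_norm (u t' - W.starProjection (u t')) e)
    (sub_pos.2 h2).le
  rcases (norm_nonneg e).eq_or_lt with h0 | h0
  · rw [← h0, mul_zero]
    exact add_nonneg (mul_nonneg (sub_pos.2 h3).le (norm_nonneg _))
      (mul_nonneg (sub_pos.2 h2).le (norm_nonneg _))
  · refine le_of_mul_le_mul_right ?_ h0
    nlinarith

/-- The distance to `W` is convex on each side of `τ` and vanishes at `τ`, so it grows at most
linearly, uniformly in the constraint times. The alternatives for `τ` and `B` allow one-sided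
windows at the ends. -/
theorem IsNetwork.norm_sub_starProjection_le_abs (hu : IsNetwork S V B u)
    (huc : ContinuousOn u (Set.Icc 0 B))
    (hS : ∀ t ∈ Set.Icc 0 B, ∃ δ > 0, ∀ σ ∈ S, |σ - t| < δ → σ = t)
    (W : Submodule ℝ E) {τ δ K : ℝ} (hδ : 0 < δ) (hτ0 : τ = 0 ∨ δ ≤ τ) (hτB : B = τ ∨ τ + δ ≤ B)
    (hτ : u τ ∈ W) (hW : ∀ σ, τ - δ < σ → σ < τ + δ → W ≤ V σ)
    (hK : ∀ x ∈ Set.Icc 0 B, |x - τ| ≤ δ → ‖u x‖ ≤ K) :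
    ∀ x ∈ Set.Icc 0 B, |x - τ| ≤ δ →
      δ * ‖u x - W.starProjection (u x)‖ ≤ |x - τ| * K := by
  intro x hx hxτ
  have hτ' : u τ - W.starProjection (u τ) = 0 := by
    rw [Submodule.starProjection_eq_self_iff.2 hτ, sub_self]
  have hle : ∀ y, ‖u y - W.starProjection (u y)‖ ≤ ‖u y‖ := by
    intro y
    rw [← Submodule.starProjection_orthogonal_val]
    exact Submodule.norm_starProjection_apply_le _ _
  have hxτ' := abs_le.1 hxτ
  rcases lt_trichotomy x τ with h | h | h
  · have h0 : δ ≤ τ := hτ0.resolve_left (by rintro rfl; exact absurd hx.1 (not_le.2 h))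
    have hτB' : τ ≤ B := by rcases hτB with h | h <;> linarith
    have h1 := hu.norm_sub_starProjection_le huc hS W (s := τ - δ) (t := τ) (by linarith)
      (by linarith) hτB' (fun σ _ h1 h2 => hW σ h1 (by linarith)) x
      ⟨by linarith, h.le⟩
    rw [hτ', norm_zero, mul_zero, add_zero] at h1
    have h2 := (hle (τ - δ)).trans (hK (τ - δ) ⟨by linarith, by linarith⟩ (by
      rw [abs_le]; constructor <;> linarith))
    rw [abs_of_neg (by linarith)]
    have h3 := mul_le_mul_of_nonneg_left h2 (sub_pos.2 h).le
    linarith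
  · subst h
    simp [hτ']
  · have h0 : τ + δ ≤ B := hτB.resolve_left (by rintro rfl; exact absurd hx.2 (not_le.2 h))
    have hτ0' : 0 ≤ τ := by rcases hτ0 with h | h <;> linarith
    have h1 := hu.norm_sub_starProjection_le huc hS W (s := τ) (t := τ + δ) hτ0'
      (by linarith) h0 (fun σ _ h1 h2 => hW σ (by linarith) h2) x
      ⟨h.le, by linarith⟩
    rw [hτ', norm_zero, mul_zero, zero_add] at h1
    have h2 := (hle (τ + δ)).trans (hK (τ + δ) ⟨by linarith, by linarith⟩ (by
      rw [abs_le]; constructor <;> linarith))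
    rw [abs_of_pos (by linarith)]
    have h3 := mul_le_mul_of_nonneg_left h2 (sub_pos.2 h).le
    linarith

/-- By Pythagoras: the component of `u - q` in `W` is affine, so its square is convex; the normal
component is the error term. -/
theorem IsNetwork.norm_sub_sq_le (hu : IsNetwork S V B u) (W : Submodule ℝ E) {s x t : ℝ}
    (hs : 0 ≤ s) (hsx : s ≤ x) (hxt : x ≤ t) (ht : t ≤ B)
    (hW : ∀ σ ∈ S, s < σ → σ < t → W ≤ V σ)
    (hq : (t - s) • W.starProjection (q x) =
      (t - x) • W.starProjection (q s) + (x - s) • W.starProjection (q t)) :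
    (t - s) * ‖u x - q x‖ ^ 2 ≤ (t - x) * ‖u s - q s‖ ^ 2 + (x - s) * ‖u t - q t‖ ^ 2 +
      (t - s) * (‖u x - W.starProjection (u x)‖ + ‖q x - W.starProjection (q x)‖) ^ 2 := by
  have hle : ∀ y, ‖W.starProjection (u y - q y)‖ ^ 2 ≤ ‖u y - q y‖ ^ 2 := fun y =>
    pow_le_pow_left₀ (norm_nonneg _) (Submodule.norm_starProjection_apply_le _ _) 2
  have hpyth : ‖u x - q x‖ ^ 2 = ‖W.starProjection (u x - q x)‖ ^ 2 +
      ‖(u x - q x) - W.starProjection (u x - q x)‖ ^ 2 := by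
    have h := norm_add_sq_eq_norm_sq_add_norm_sq_of_inner_eq_zero
      (W.starProjection (u x - q x)) ((u x - q x) - W.starProjection (u x - q x))
      ((Submodule.mem_orthogonal _ _).1 (W.sub_starProjection_mem_orthogonal _) _
        (W.starProjection_apply_mem _))
    rw [add_sub_cancel] at h
    simpa only [sq] using h
  have hI : ‖(u x - q x) - W.starProjection (u x - q x)‖ ≤
      ‖u x - W.starProjection (u x)‖ + ‖q x - W.starProjection (q x)‖ := by
    rw [map_sub, sub_sub_sub_comm]
    exact norm_sub_le _ _
  have hI2 := mul_le_mul_of_nonneg_left (pow_le_pow_left₀ (norm_nonneg _) hI 2)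
    (sub_nonneg.2 (hsx.trans hxt))
  have hch : (t - s) • W.starProjection (u x - q x) =
      (t - x) • W.starProjection (u s - q s) + (x - s) • W.starProjection (u t - q t) := by
    simp only [map_sub, smul_sub, hu.starProjection_chord W hs hsx hxt ht hW, hq]
    abel
  set p := W.starProjection (u s - q s)
  set r := W.starProjection (u t - q t)
  set y := W.starProjection (u x - q x)
  have hconv : (t - s) * ‖y‖ ^ 2 ≤ (t - x) * ‖p‖ ^ 2 + (x - s) * ‖r‖ ^ 2 := by
    rcases (hsx.trans hxt).eq_or_lt with h | h
    · have h1 : x = s := le_antisymm (by linarith) hsx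
      have h2 : t = s := h.symm
      simp [h1, h2]
    · refine le_of_mul_le_mul_left ?_ (sub_pos.2 h)
      have h1 : (t - s) * ‖y‖ ≤ (t - x) * ‖p‖ + (x - s) * ‖r‖ := by
        have := congrArg norm hch
        rw [norm_smul, Real.norm_of_nonneg (sub_pos.2 h).le] at this
        rw [this]
        refine (norm_add_le _ _).trans (le_of_eq ?_)
        rw [norm_smul, norm_smul, Real.norm_of_nonneg (sub_nonneg.2 hxt),
          Real.norm_of_nonneg (sub_nonneg.2 hsx)]
      have h2 := pow_le_pow_left₀ (mul_nonneg (sub_pos.2 h).le (norm_nonneg y)) h1 2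
      have h3 := mul_nonneg (mul_nonneg (sub_nonneg.2 hxt) (sub_nonneg.2 hsx))
        (sq_nonneg (‖p‖ - ‖r‖))
      linear_combination h2 + h3
  have hp := mul_le_mul_of_nonneg_left (hle s) (sub_nonneg.2 hxt)
  have hr := mul_le_mul_of_nonneg_left (hle t) (sub_nonneg.2 hsx)
  rw [hpyth, mul_add]
  linarith

end Network

/-! ### The self-improving bound and the passage to the whole interval -/

section Network

variable {E : Type*} [NormedAddCommGroup E] [InnerProductSpace ℝ E]
  {S : Set ℝ} {V : ℝ → Submodule ℝ E} {B : ℝ} {u q : ℝ → E} {ψ : ℝ → ℝ}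

theorem IsNetwork.mono (hu : IsNetwork S V B u) {B' : ℝ} (h : B' ≤ B) : IsNetwork S V B' u :=
  ⟨fun σ hσ h0 h1 => hu.mem σ hσ h0 (h1.trans h),
    fun s x t h0 h1 h2 h3 => hu.chord s x t h0 h1 h2 (h3.trans h)⟩

theorem IsNetwork.congr (hu : IsNetwork S V B u) {u' : ℝ → E}
    (h : ∀ t, 0 ≤ t → t ≤ B → u' t = u t) : IsNetwork S V B u' := by
  refine ⟨fun σ hσ h0 h1 => h σ h0 h1 ▸ hu.mem σ hσ h0 h1, fun s x t h0 h1 h2 h3 => ?_⟩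
  rw [h s h0 (by linarith), h x (by linarith) (by linarith), h t (by linarith) h3]
  exact hu.chord s x t h0 h1 h2 h3

/-- The weak form of the kink condition involves only finitely many values of `u` at a time, so it
survives pointwise limits. -/
theorem isClosed_setOf_isNetwork [FiniteDimensional ℝ E] (S : Set ℝ) (V : ℝ → Submodule ℝ E)
    (B : ℝ) : IsClosed {u | IsNetwork S V B u} := by
  have : {u | IsNetwork S V B u} = {u | ∀ σ ∈ S, 0 ≤ σ → σ ≤ B → u σ ∈ V σ} ∩
      {u | ∀ s x t, 0 ≤ s → s ≤ x → x ≤ t → t ≤ B →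
        ∀ v, (∀ σ ∈ S, s < σ → σ < t → v ∈ V σ) →
        (t - s) * inner ℝ (u x) v = (t - x) * inner ℝ (u s) v + (x - s) * inner ℝ (u t) v} := by
    ext u
    exact ⟨fun h => ⟨h.1, h.2⟩, fun h => ⟨h.1, h.2⟩⟩
  rw [this]
  refine IsClosed.inter ?_ ?_
  · simp only [Set.ofPred_forall]
    refine isClosed_iInter fun σ => isClosed_iInter fun _ => isClosed_iInter fun _ =>
      isClosed_iInter fun _ => ?_
    exact (Submodule.closed_of_finiteDimensional (V σ)).preimage (continuous_apply σ)
  · simp only [Set.ofPred_forall]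
    refine isClosed_iInter fun s => isClosed_iInter fun x => isClosed_iInter fun t =>
      isClosed_iInter fun _ => isClosed_iInter fun _ => isClosed_iInter fun _ =>
      isClosed_iInter fun _ => isClosed_iInter fun v => isClosed_iInter fun _ => ?_
    exact isClosed_eq (by fun_prop) (by fun_prop)

variable [FiniteDimensional ℝ E]

/-- Near a constraint time `τ` of an equilibrium `u`, the bound `‖u - q‖² ≤ c ψ` improves itself
to a strict inequality; the size of the neighborhood depends neither on `u` nor on the other
constraint times. -/
theorem exists_gauge {τ : ℝ} (h0 : 0 ≤ τ) (𝓑 : Set ℝ)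
    (hB : ∃ δ > 0, ∀ B ∈ 𝓑, τ ≤ B → B = τ ∨ τ + δ ≤ B)
    (hq : ContinuousAt q τ) (hqV : q τ ∈ V τ)
    (hloc : ∃ δ > 0, (∀ s, τ - δ < s → s < τ + δ → V τ ≤ V s) ∧
      ∀ s x t, τ - δ < s → s ≤ x → x ≤ t → t < τ + δ →
      (t - s) • (V τ).starProjection (q x) =
        (t - x) • (V τ).starProjection (q s) + (x - s) • (V τ).starProjection (q t))
    (hψ : Continuous ψ) (hconc : ∀ t δ, 0 < δ → ψ (t - δ) + ψ (t + δ) < 2 * ψ t)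
    (hψτ : 0 < ψ τ) :
    ∃ η > 0, ∀ B ∈ 𝓑, τ ≤ B → ∀ (S : Set ℝ) (u : ℝ → E),
      (∀ t ∈ Set.Icc 0 B, ∃ δ > 0, ∀ σ ∈ S, |σ - t| < δ → σ = t) →
      IsNetwork S V B u → ContinuousOn u (Set.Icc 0 B) → u 0 = q 0 → u B = q B → u τ ∈ V τ →
      ∀ c : ℝ, 1 ≤ c → (∀ y ∈ Set.Icc 0 B, ‖u y - q y‖ ^ 2 ≤ c * ψ y) →
      ∀ x ∈ Set.Icc 0 B, |x - τ| < η → ‖u x - q x‖ ^ 2 < c * ψ x := by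
  obtain ⟨δB, hδB, hB⟩ := hB
  obtain ⟨δL, hδL, hV, hch⟩ := hloc
  -- With this `R`, both `‖q y‖ < R` and `ψ y < R ^ 2` hold near `τ`, whence `‖u y‖ ≤ 2 R √c`.
  set R : ℝ := ‖q τ‖ + ψ τ + 1 with hR
  have hR1 : 1 ≤ R := by have := norm_nonneg (q τ); linarith
  have hbound : ∀ᶠ y in 𝓝 τ, ‖q y‖ < R ∧ ψ y < R ^ 2 := by
    refine (hq.norm.eventually_lt_const (by linarith)).and
      (hψ.continuousAt.eventually_lt_const ?_)
    have := norm_nonneg (q τ)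
    nlinarith
  obtain ⟨δR, hδR, hRb⟩ := Metric.eventually_nhds_iff.1 hbound
  obtain ⟨δ, hδ, hδ1, hδ2, hδ3, hδ4⟩ : ∃ δ > 0, δ < δB ∧ δ < δL ∧ δ < δR ∧ (τ = 0 ∨ δ ≤ τ) := by
    rcases h0.eq_or_lt with h | h
    · obtain ⟨δ, h1, h2⟩ := exists_between (lt_min hδB (lt_min hδL hδR))
      simp only [lt_min_iff] at h2
      exact ⟨δ, h1, h2.1, h2.2.1, h2.2.2, Or.inl h.symm⟩
    · obtain ⟨δ, h1, h2⟩ := exists_between (lt_min h (lt_min hδB (lt_min hδL hδR)))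
      simp only [lt_min_iff] at h2
      exact ⟨δ, h1, h2.2.1, h2.2.2.1, h2.2.2.2, Or.inr h2.1.le⟩
  set P := (V τ).starProjection with hP
  -- Bound, up to the factor `c`, for the squared normal component of `u - q`. It vanishes at `τ`
  -- and involves neither `u` nor `S`.
  set e : ℝ → ℝ := fun x => (2 * R * |x - τ| / δ + ‖q x - P (q x)‖) ^ 2 with he
  have hec : ContinuousAt e τ := by
    have : ContinuousAt (fun x => P (q x)) τ := P.continuous.continuousAt.comp hq
    simp only [he]
    fun_prop
  have heτ : e τ = 0 := by
    simp only [he, hP, Submodule.starProjection_eq_self_iff.2 hqV]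
    simp
  have hψc : ContinuousAt ψ τ := hψ.continuousAt
  -- At `x = τ` this is the strict concavity of `ψ`. It serves two-sided windows, `hGb` the
  -- one-sided ones at `0` and `B`, where `u = q` at one end of the chord.
  have hGa : ∀ᶠ x in 𝓝 τ,
      2 * δ * (e x - ψ x) + (τ + δ - x) * ψ (τ - δ) + (x - (τ - δ)) * ψ (τ + δ) < 0 := by
    have hc : ContinuousAt (fun x => 2 * δ * (e x - ψ x) + (τ + δ - x) * ψ (τ - δ) +
      (x - (τ - δ)) * ψ (τ + δ)) τ := by fun_prop
    refine hc.eventually_lt_const ?_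
    have := mul_lt_mul_of_pos_left (hconc τ δ hδ) hδ
    simp only [heτ]
    linarith
  have hGb : ∀ᶠ x in 𝓝 τ,
      |x - τ| * (|ψ (τ - δ)| + |ψ (τ + δ)|) + δ * (e x - ψ x) < 0 := by
    have hc : ContinuousAt (fun x => |x - τ| * (|ψ (τ - δ)| + |ψ (τ + δ)|) +
      δ * (e x - ψ x)) τ := by fun_prop
    refine hc.eventually_lt_const ?_
    have := mul_pos hδ hψτ
    simp only [heτ, sub_self, abs_zero]
    linarith
  obtain ⟨η, hη, hG⟩ := Metric.eventually_nhds_iff.1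
    ((hGa.and hGb).and (hψc.eventually_const_lt hψτ))
  refine ⟨min η δ, lt_min hη hδ, fun B hBm hτB S u hS hu huc hu0 huB huτ c hc hf x hx hxτ => ?_⟩
  obtain ⟨⟨hGa, hGb⟩, hψx⟩ := hG (y := x) (by
    rw [Real.dist_eq]; exact hxτ.trans_le (min_le_left _ _))
  have hxδ : |x - τ| ≤ δ := (hxτ.trans_le (min_le_right _ _)).le
  have hBδ : B = τ ∨ τ + δ ≤ B := (hB B hBm hτB).imp_right fun h => by linarith
  have hVδ : ∀ σ, τ - δ < σ → σ < τ + δ → V τ ≤ V σ := fun σ h1 h2 =>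
    hV σ (by linarith) (by linarith)
  have hc0 : 0 ≤ c := by linarith
  have hsc : 1 ≤ √c := Real.one_le_sqrt.2 hc
  have hK : ∀ y ∈ Set.Icc 0 B, |y - τ| ≤ δ → ‖u y‖ ≤ √c * (2 * R) := by
    intro y hy hyδ
    obtain ⟨h1, h2⟩ := hRb (y := y) (by rw [Real.dist_eq]; linarith)
    have h3 : ‖u y - q y‖ ≤ √c * R := by
      refine le_of_sq_le_sq ?_ (by positivity)
      rw [mul_pow, Real.sq_sqrt hc0]
      exact (hf y hy).trans (mul_le_mul_of_nonneg_left h2.le hc0)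
    have h4 : ‖u y‖ ≤ ‖u y - q y‖ + ‖q y‖ := by
      simpa using norm_add_le (u y - q y) (q y)
    nlinarith
  have hI : (‖u x - P (u x)‖ + ‖q x - P (q x)‖) ^ 2 ≤ c * e x := by
    have h1 := hu.norm_sub_starProjection_le_abs huc hS (V τ) hδ hδ4 hBδ huτ hVδ hK x hx hxδ
    have h2 : ‖u x - P (u x)‖ ≤ √c * (2 * R * |x - τ| / δ) := by
      rw [mul_div_assoc', le_div_iff₀ hδ]
      linarith
    have h3 : ‖u x - P (u x)‖ + ‖q x - P (q x)‖ ≤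
        √c * (2 * R * |x - τ| / δ + ‖q x - P (q x)‖) := by
      -- Here `c ≥ 1` is essential: the contribution of `q` does not scale with `c`.
      have := mul_le_mul_of_nonneg_right hsc (norm_nonneg (q x - P (q x)))
      linarith
    have h4 := pow_le_pow_left₀ (by positivity) h3 2
    rwa [mul_pow, Real.sq_sqrt hc0] at h4
  have main : ∀ s t, τ - δ ≤ s → t ≤ τ + δ → 0 ≤ s → t ≤ B → s ≤ x → x ≤ t →
      (t - s) * ‖u x - q x‖ ^ 2 ≤ (t - x) * ‖u s - q s‖ ^ 2 + (x - s) * ‖u t - q t‖ ^ 2 +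
        (t - s) * (c * e x) := by
    intro s t h1 h2 h3 h4 h5 h6
    refine (hu.norm_sub_sq_le (V τ) h3 h5 h6 h4 (fun σ _ h7 h8 => hVδ σ (by linarith)
      (by linarith)) (hch s x t (by linarith) h5 h6 (by linarith))).trans ?_
    have := mul_le_mul_of_nonneg_left hI (by linarith : 0 ≤ t - s)
    linarith
  have hend : u x = q x → ‖u x - q x‖ ^ 2 < c * ψ x := by
    intro h
    rw [h, sub_self, norm_zero, zero_pow two_ne_zero]
    exact mul_pos (by linarith) hψx
  have hxδ' := abs_le.1 hxδ
  have hcpos : 0 < c := by linarith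
  have hGb' : c * (|x - τ| * (|ψ (τ - δ)| + |ψ (τ + δ)|)) + c * (δ * (e x - ψ x)) < 0 := by
    rw [← mul_add]
    exact mul_neg_of_pos_of_neg hcpos hGb
  have hxa := mul_nonneg hc0 (abs_nonneg (x - τ))
  by_cases hτ0 : τ = 0
  · by_cases hx0 : x = 0
    · exact hend (by rw [hx0, hu0])
    have hxpos : 0 < x := lt_of_le_of_ne hx.1 (Ne.symm hx0)
    have hBτ : τ + δ ≤ B := hBδ.resolve_left fun h => by linarith [hx.2]
    have h1 := main τ (τ + δ) (by linarith) le_rfl h0 hBτ (by linarith) (by linarith)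
    have h2 : ‖u τ - q τ‖ ^ 2 = 0 := by rw [hτ0, hu0]; simp
    have h3 := mul_le_mul_of_nonneg_left (hf (τ + δ) ⟨by linarith, hBτ⟩)
      (by linarith : 0 ≤ x - τ)
    have h4 : |x - τ| = x - τ := abs_of_nonneg (by linarith)
    rw [h4] at hGb' hxa
    have h5 := mul_le_mul_of_nonneg_left (le_abs_self (ψ (τ + δ))) hxa
    have h6 := mul_nonneg hxa (abs_nonneg (ψ (τ - δ)))
    refine lt_of_mul_lt_mul_left ?_ hδ.le
    rw [h2] at h1
    linarith
  · have hδτ : δ ≤ τ := hδ4.resolve_left hτ0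
    rcases hBδ with hBτ | hBτ
    · have hxle : x ≤ τ := hBτ ▸ hx.2
      have h1 := main (τ - δ) τ le_rfl (by linarith) (by linarith) hBτ.ge (by linarith) hxle
      have h2 : ‖u τ - q τ‖ ^ 2 = 0 := by rw [← hBτ, huB]; simp
      have h3 := mul_le_mul_of_nonneg_left (hf (τ - δ) ⟨by linarith, by linarith⟩)
        (by linarith : 0 ≤ τ - x)
      have h4 : |x - τ| = τ - x := by rw [abs_of_nonpos (by linarith)]; ring
      rw [h4] at hGb' hxa
      have h5 := mul_le_mul_of_nonneg_left (le_abs_self (ψ (τ - δ))) hxa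
      have h6 := mul_nonneg hxa (abs_nonneg (ψ (τ + δ)))
      refine lt_of_mul_lt_mul_left ?_ hδ.le
      rw [h2] at h1
      linarith
    · have h1 := main (τ - δ) (τ + δ) le_rfl le_rfl (by linarith) hBτ (by linarith)
        (by linarith)
      have h2 := mul_le_mul_of_nonneg_left (hf (τ - δ) ⟨by linarith, by linarith⟩)
        (by linarith : 0 ≤ τ + δ - x)
      have h3 := mul_le_mul_of_nonneg_left (hf (τ + δ) ⟨by linarith, hBτ⟩)
        (by linarith : 0 ≤ x - (τ - δ))
      have h4 := mul_neg_of_pos_of_neg hcpos hGa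
      refine lt_of_mul_lt_mul_left ?_ (by linarith : 0 ≤ 2 * δ)
      linarith

/-- If the maximum of `f / ψ` were at least `1`, it would be an admissible `c`, attained, in
contradiction to the strict inequality. -/
theorem le_of_forall_improve {f : ℝ → ℝ} (hB : 0 ≤ B) (hf : ContinuousOn f (Set.Icc 0 B))
    (hψ : ContinuousOn ψ (Set.Icc 0 B)) (hpos : ∀ t ∈ Set.Icc 0 B, 0 < ψ t)
    (H : ∀ c : ℝ, 1 ≤ c → (∀ y ∈ Set.Icc 0 B, f y ≤ c * ψ y) →
      ∀ x ∈ Set.Icc 0 B, f x < c * ψ x) :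
    ∀ y ∈ Set.Icc 0 B, f y ≤ ψ y := by
  obtain ⟨z, hz, hmax⟩ := isCompact_Icc.exists_isMaxOn ⟨0, le_rfl, hB⟩
    (hf.div hψ fun t ht => (hpos t ht).ne')
  have hle : ∀ y ∈ Set.Icc 0 B, f y ≤ f z / ψ z * ψ y := fun y hy =>
    (div_le_iff₀ (hpos y hy)).1 (hmax hy)
  rcases le_total (f z / ψ z) 1 with h | h
  · intro y hy
    have := mul_le_mul_of_nonneg_right h (hpos y hy).le
    linarith [hle y hy]
  · have := H _ h hle z hz
    rw [div_mul_cancel₀ _ (hpos z hz).ne'] at this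
    exact absurd this (lt_irrefl _)

/-- The radii from `exists_gauge` are known before `S`, so `S` comes from finite subcovers. The
equilibria on `[0, b (N + 1)]` need not extend each other; a common limit exists because the
admissible curves form nested nonempty compact sets for pointwise convergence. -/
theorem exists_isNetwork_near {b : ℕ → ℝ} (hb : StrictMono b) (hb0 : b 0 = 0)
    (hq : ∀ t, 0 ≤ t → (∃ N, t < b N) → ContinuousAt q t)
    (hqV : ∀ t, 0 ≤ t → (∃ N, t < b N) → q t ∈ V t)
    (hloc : ∀ τ, 0 ≤ τ → (∃ N, τ < b N) →
      ∃ δ > 0, (∀ s, τ - δ < s → s < τ + δ → V τ ≤ V s) ∧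
        ∀ s x t, τ - δ < s → s ≤ x → x ≤ t → t < τ + δ →
        (t - s) • (V τ).starProjection (q x) =
          (t - x) • (V τ).starProjection (q s) + (x - s) • (V τ).starProjection (q t))
    (hψ : Continuous ψ) (hconc : ∀ t δ, 0 < δ → ψ (t - δ) + ψ (t + δ) < 2 * ψ t)
    (hpos : ∀ t, 0 ≤ t → (∃ N, t < b N) → 0 < ψ t) :
    ∃ (S : Set ℝ) (u : ℝ → E),
      (∀ t, 0 ≤ t → (∃ N, t < b N) → ∃ δ > 0, ∀ σ ∈ S, |σ - t| < δ → σ = t) ∧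
      (∀ N, IsNetwork S V (b N) u) ∧ u 0 = q 0 ∧
      ∀ t, 0 ≤ t → (∃ N, t < b N) → ‖u t - q t‖ ^ 2 ≤ ψ t := by
  have hb_nonneg : ∀ j, 0 ≤ b j := fun j => hb0 ▸ hb.monotone (Nat.zero_le j)
  have hdom : ∀ N t, t ≤ b N → ∃ N, t < b N := fun N t h =>
    ⟨N + 1, h.trans_lt (hb (Nat.lt_succ_self N))⟩
  have hgauge : ∀ τ, 0 ≤ τ → (∃ N, τ < b N) → _ := fun τ h0 h1 =>
    exists_gauge (V := V) (q := q) h0 (Set.range b) (by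
      classical
      -- The distance to the first `b N` beyond `τ` keeps every right end other than `τ` itself out
      -- of the window.
      refine ⟨b (Nat.find h1) - τ, sub_pos.2 (Nat.find_spec h1), ?_⟩
      rintro _ ⟨j, rfl⟩ hj
      rcases hj.eq_or_lt with h | h
      · exact Or.inl h.symm
      · right
        have := hb.monotone (Nat.find_min' h1 h)
        linarith) (hq τ h0 h1) (hqV τ h0 h1) (hloc τ h0 h1) hψ hconc (hpos τ h0 h1)
  choose! η hη hgauge using hgauge
  have hcov : ∀ j, ∃ F : Finset ℝ, (∀ τ ∈ F, τ ∈ Set.Icc (b j) (b (j + 1))) ∧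
      Set.Icc (b j) (b (j + 1)) ⊆ ⋃ τ ∈ F, Metric.ball τ (η τ) := fun j =>
    isCompact_Icc.elim_nhds_subcover (fun τ => Metric.ball τ (η τ)) fun τ hτ =>
      Metric.ball_mem_nhds τ (hη τ ((hb_nonneg j).trans hτ.1) (hdom _ _ hτ.2))
  choose F hFmem hFcov using hcov
  set S : Set ℝ := ⋃ j, (F j : Set ℝ) with hS
  have hS0 : ∀ σ ∈ S, 0 ≤ σ := by
    intro σ hσ
    obtain ⟨j, hj⟩ := Set.mem_iUnion.1 hσ
    exact (hb_nonneg j).trans (hFmem j σ hj).1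
  have hSfin : ∀ N, (S ∩ Set.Icc 0 (b N)).Finite := by
    intro N
    refine Set.Finite.subset (((Finset.range (N + 1)).biUnion F).finite_toSet) ?_
    rintro σ ⟨hσ, _, h2⟩
    obtain ⟨j, hj⟩ := Set.mem_iUnion.1 hσ
    have hjN : j ≤ N := hb.le_iff_le.1 ((hFmem j σ hj).1.trans h2)
    exact Finset.mem_coe.2 (Finset.mem_biUnion.2 ⟨j, Finset.mem_range.2 (by omega), hj⟩)
  have hSloc : ∀ t, 0 ≤ t → (∃ N, t < b N) → ∃ δ > 0, ∀ σ ∈ S, |σ - t| < δ → σ = t := by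
    rintro t - ⟨N, hN⟩
    have h1 : ((S ∩ Set.Icc 0 (b N)) \ {t})ᶜ ∈ 𝓝 t :=
      ((hSfin N).subset Set.sdiff_subset).isClosed.isOpen_compl.mem_nhds (by simp)
    obtain ⟨δ, hδ, h⟩ := Metric.mem_nhds_iff.1 (inter_mem h1 (Iio_mem_nhds hN))
    refine ⟨δ, hδ, fun σ hσ hd => ?_⟩
    obtain ⟨h2, h3⟩ := h (show σ ∈ Metric.ball t δ by rwa [Metric.mem_ball, Real.dist_eq])
    by_contra hne
    exact h2 ⟨⟨hσ, hS0 σ hσ, le_of_lt h3⟩, hne⟩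
  have hScov : ∀ N x, x ∈ Set.Icc 0 (b (N + 1)) →
      ∃ τ ∈ S, τ ≤ b (N + 1) ∧ |x - τ| < η τ := by
    intro N
    induction N with
    | zero =>
      intro x hx
      obtain ⟨τ, hτ, hd⟩ := Set.mem_iUnion₂.1 (hFcov 0 (by rwa [hb0] : x ∈ _))
      exact ⟨τ, Set.mem_iUnion.2 ⟨0, hτ⟩, (hFmem 0 τ hτ).2, hd⟩
    | succ N ih =>
      intro x hx
      rcases le_total x (b (N + 1)) with h | h
      · obtain ⟨τ, h1, h2, h3⟩ := ih x ⟨hx.1, h⟩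
        exact ⟨τ, h1, h2.trans (hb (Nat.lt_succ_self _)).le, h3⟩
      · obtain ⟨τ, hτ, hd⟩ := Set.mem_iUnion₂.1 (hFcov (N + 1) ⟨h, hx.2⟩)
        exact ⟨τ, Set.mem_iUnion.2 ⟨N + 1, hτ⟩, (hFmem (N + 1) τ hτ).2, hd⟩
  have hstage : ∀ N, ∃ u, IsNetwork S V (b (N + 1)) u ∧ u 0 = q 0 ∧
      ∀ t ∈ Set.Icc 0 (b (N + 1)), ‖u t - q t‖ ^ 2 ≤ ψ t := by
    intro N
    have hBpos : 0 < b (N + 1) := hb0 ▸ hb (Nat.succ_pos N)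
    obtain ⟨u, huc, hu, hu0, huB⟩ := exists_isNetwork S V hBpos (hSfin (N + 1)) q
      fun t ht => hqV t ht.1 (hdom _ _ ht.2)
    refine ⟨u, hu, hu0, le_of_forall_improve hBpos.le ?_ hψ.continuousOn
      (fun t ht => hpos t ht.1 (hdom _ _ ht.2)) fun c hc hf x hx => ?_⟩
    · have hqc : ContinuousOn q (Set.Icc 0 (b (N + 1))) := fun t ht =>
        (hq t ht.1 (hdom _ _ ht.2)).continuousWithinAt
      exact ((huc.continuousOn.sub hqc).norm.pow 2)
    · obtain ⟨τ, hτS, hτle, hd⟩ := hScov N x hx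
      exact hgauge τ (hS0 τ hτS) (hdom _ _ hτle) (b (N + 1)) ⟨N + 1, rfl⟩ hτle S u
        (fun t ht => hSloc t ht.1 (hdom _ _ ht.2)) hu huc.continuousOn hu0 huB
        (hu.mem τ hτS (hS0 τ hτS) hτle) c hc hf x hx hd
  classical
  set C : ℝ → Set E := fun t =>
    if 0 ≤ t ∧ ∃ N, t < b N then Metric.closedBall (q t) √(ψ t) else {0} with hC
  have hCcomp : IsCompact (Set.univ.pi C) := by
    refine isCompact_univ_pi fun t => ?_
    simp only [hC]
    split_ifs
    · exact isCompact_closedBall _ _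
    · exact isCompact_singleton
  set A : ℕ → Set (ℝ → E) := fun N =>
    Set.univ.pi C ∩ ({u | IsNetwork S V (b (N + 1)) u} ∩ {u | u 0 = q 0}) with hA
  have hAclosed : ∀ N, IsClosed (A N) := fun N =>
    hCcomp.isClosed.inter ((isClosed_setOf_isNetwork _ _ _).inter
      (isClosed_eq (continuous_apply _) continuous_const))
  have hAne : ∀ N, (A N).Nonempty := by
    intro N
    obtain ⟨u, hu, hu0, hb'⟩ := hstage N
    -- Beyond the stage the curve continues as `q`, and outside the domain as `0`, only to belong to
    -- the compact product.
    refine ⟨fun t => if 0 ≤ t ∧ ∃ N, t < b N then if t ≤ b (N + 1) then u t else q t else 0,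
      fun t _ => ?_, hu.congr fun t h0 h1 => ?_, ?_⟩
    · simp only [hC]
      by_cases h : 0 ≤ t ∧ ∃ N, t < b N
      · rw [if_pos h, if_pos h]
        split_ifs with h1
        · rw [Metric.mem_closedBall, dist_eq_norm]
          exact Real.le_sqrt_of_sq_le (hb' t ⟨h.1, h1⟩)
        · exact Metric.mem_closedBall_self (Real.sqrt_nonneg _)
      · rw [if_neg h, if_neg h]
        exact Set.mem_singleton _
    · rw [if_pos ⟨h0, hdom _ _ h1⟩, if_pos h1]
    · have h1 : ∃ N, 0 < b N := hdom 0 0 hb0.ge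
      simp only [Set.mem_ofPred_eq]
      rw [if_pos ⟨le_rfl, h1⟩, if_pos (hb_nonneg _), hu0]
  have hAanti : ∀ N, A (N + 1) ⊆ A N := fun N u hu =>
    ⟨hu.1, IsNetwork.mono hu.2.1 (hb.monotone (Nat.le_succ _)), hu.2.2⟩
  obtain ⟨u, hu⟩ := IsCompact.nonempty_iInter_of_sequence_nonempty_isCompact_isClosed A hAanti
    hAne (hCcomp.of_isClosed_subset (hAclosed 0) Set.inter_subset_left) hAclosed
  rw [Set.mem_iInter] at hu
  refine ⟨S, u, hSloc, fun N => IsNetwork.mono (hu N).2.1 (hb.monotone (Nat.le_succ _)),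
    (hu 0).2.2, fun t h0 h1 => ?_⟩
  have := (hu 0).1 t (Set.mem_univ _)
  simp only [hC] at this
  rw [if_pos ⟨h0, h1⟩, Metric.mem_closedBall, dist_eq_norm] at this
  have h2 := pow_le_pow_left₀ (norm_nonneg _) this 2
  rwa [Real.sq_sqrt (hpos t h0 h1).le] at h2

end Network

/-! ### Barycenters of clusters -/

section Projection

theorem extProj_add (m : Fin n → ℝ) (C : Setoid (Fin n)) (x y : Config n d) :
    extProj m C (x + y) = extProj m C x + extProj m C y := by
  funext i
  simp [extProj, smul_add, Finset.sum_add_distrib]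

theorem extProj_smul (m : Fin n → ℝ) (C : Setoid (Fin n)) (c : ℝ) (x : Config n d) :
    extProj m C (c • x) = c • extProj m C x := by
  funext i
  simp only [extProj, Pi.smul_apply, smul_comm _ c, ← Finset.smul_sum]

theorem extProj_apply_eq_of_rel (m : Fin n → ℝ) {C : Setoid (Fin n)} {i j : Fin n} (h : C i j)
    (x : Config n d) : extProj m C x i = extProj m C x j := by
  classical
  have : (Finset.univ.filter fun k => C i k) = Finset.univ.filter fun k => C j k := by
    ext k
    simpa using ⟨fun h' => C.trans (C.symm h) h', fun h' => C.trans h h'⟩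
  have key : ∀ F G : Finset (Fin n), F = G →
      (∑ k ∈ F, m k)⁻¹ • ∑ k ∈ F, m k • x k = (∑ k ∈ G, m k)⁻¹ • ∑ k ∈ G, m k • x k := by
    rintro F _ rfl
    rfl
  refine key _ _ ?_
  convert this

theorem sum_mass_pos {m : Fin n → ℝ} (hm : ∀ i, 0 < m i) (C : Setoid (Fin n)) (i : Fin n)
    [DecidablePred fun j => C i j] : 0 < ∑ j with C i j, m j :=
  Finset.sum_pos (fun j _ => hm j) ⟨i, by simp⟩

theorem extProj_eq_self {m : Fin n → ℝ} (hm : ∀ i, 0 < m i) {C : Setoid (Fin n)}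
    {x : Config n d} (hx : ∀ i j, C i j → x i = x j) : extProj m C x = x := by
  classical
  funext i
  have h : ∑ j with C i j, m j • x j = (∑ j with C i j, m j) • x i := by
    rw [Finset.sum_smul]
    refine Finset.sum_congr rfl fun j hj => ?_
    rw [hx i j (Finset.mem_filter.1 hj).2]
  simp only [extProj]
  rw [h, smul_smul]
  have := (sum_mass_pos hm C i).ne'
  rw [inv_mul_cancel₀ (by convert this), one_smul]

/-- This is the orthogonality of the cluster projection in the mass metric: averaging within
clusters is invisible to vectors that are constant on clusters. -/
theorem sum_mass_inner_extProj {m : Fin n → ℝ} (hm : ∀ i, 0 < m i) {C : Setoid (Fin n)}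
    (x : Config n d) {y : Config n d} (hy : ∀ i j, C i j → y i = y j) :
    ∑ i, m i * inner ℝ (extProj m C x i) (y i) = ∑ i, m i * inner ℝ (x i) (y i) := by
  classical
  have h1 : ∀ i, m i * inner ℝ (extProj m C x i) (y i) =
      ∑ j, if C i j then m i * (∑ k with C i k, m k)⁻¹ * (m j * inner ℝ (x j) (y j)) else 0 := by
    intro i
    simp only [extProj]
    rw [real_inner_smul_left, sum_inner, Finset.mul_sum, Finset.mul_sum, ← Finset.sum_filter]
    refine Finset.sum_congr (by congr) fun j hj => ?_
    rw [real_inner_smul_left, hy i j (Finset.mem_filter.1 hj).2]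
    rw [mul_assoc]
  rw [Finset.sum_congr rfl fun i _ => h1 i, Finset.sum_comm]
  refine Finset.sum_congr rfl fun j _ => ?_
  rw [← Finset.sum_filter, ← Finset.sum_mul]
  have h2 : ∑ i with C i j, m i * (∑ k with C i k, m k)⁻¹ = 1 := by
    have h3 : ∀ i ∈ Finset.univ.filter (fun i => C i j), m i * (∑ k with C i k, m k)⁻¹ =
        m i * (∑ k with C j k, m k)⁻¹ := by
      intro i hi
      have hij := (Finset.mem_filter.1 hi).2
      have : ∀ k, C i k ↔ C j k := fun k =>
        ⟨fun h' => C.trans (C.symm hij) h', fun h' => C.trans hij h'⟩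
      simp only [this]
    rw [Finset.sum_congr rfl h3, ← Finset.sum_mul]
    have h4 : (Finset.univ.filter fun i => C i j) = Finset.univ.filter fun i => C j i := by
      ext i
      simp [C.comm' (x := i) (y := j)]
    rw [h4, mul_inv_cancel₀ (sum_mass_pos hm C j).ne']
  rw [h2, one_mul]

theorem sum_mass_smul_extProj {m : Fin n → ℝ} (hm : ∀ i, 0 < m i) (C : Setoid (Fin n))
    (x : Config n d) : ∑ i, m i • extProj m C x i = ∑ i, m i • x i := by
  refine ext_inner_right ℝ fun e => ?_
  simpa only [sum_inner, real_inner_smul_left] using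
    sum_mass_inner_extProj hm (C := C) x (y := fun _ => e) fun _ _ _ => rfl

end Projection

/-! ### Collision subspaces in the mass metric -/

section MassMetric

/-- Configurations with the Euclidean metric in which the mass metric is realized. -/
abbrev MassSpace (n d : ℕ) : Type := PiLp 2 fun _ : Fin n => EuclideanSpace ℝ (Fin d)

/-- The isomorphism `q ↦ (√m_i q_i)_i`, which takes the mass metric to the Euclidean one. -/
noncomputable def massEquiv (d : ℕ) {m : Fin n → ℝ} (hm : ∀ i, 0 < m i) :
    Config n d ≃ₗ[ℝ] MassSpace n d where
  toFun x := WithLp.toLp 2 fun i => √(m i) • x i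
  invFun y := fun i => (√(m i))⁻¹ • y i
  map_add' x y := by ext i; simp
  map_smul' c x := by ext i; simp; ring
  left_inv x := by
    funext i
    simp [smul_smul, (Real.sqrt_pos.2 (hm i)).ne']
  right_inv y := by
    ext i
    simp [(Real.sqrt_pos.2 (hm i)).ne']

variable {m : Fin n → ℝ} (hm : ∀ i, 0 < m i)

theorem inner_massEquiv (x y : Config n d) :
    inner ℝ (massEquiv d hm x) (massEquiv d hm y) = ∑ i, m i * inner ℝ (x i) (y i) := by
  rw [PiLp.inner_apply]
  refine Finset.sum_congr rfl fun i _ => ?_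
  simp only [massEquiv, LinearEquiv.coe_mk, LinearMap.coe_mk, AddHom.coe_mk]
  rw [real_inner_smul_left, real_inner_smul_right, ← mul_assoc, Real.mul_self_sqrt (hm i).le]

theorem continuous_massEquiv : Continuous (massEquiv d hm) := by
  have h : Continuous fun x : Config n d => fun i => √(m i) • x i := by fun_prop
  exact (PiLp.continuous_toLp 2 _).comp h

theorem continuous_massEquiv_symm : Continuous (massEquiv d hm).symm := by
  have h : Continuous fun y : MassSpace n d => fun i => (√(m i))⁻¹ • y i := by fun_prop
  exact h

/-- The collision subspace of `C` as a submodule. -/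
def collisionSubmodule (d : ℕ) (m : Fin n → ℝ) (C : Setoid (Fin n)) :
    Submodule ℝ (Config n d) where
  carrier := collisionSubspace m C
  add_mem' := fun ha hb => ⟨add_mem ha.1 hb.1, fun i j h => by
    simp [ha.2 i j h, hb.2 i j h]⟩
  zero_mem' := ⟨zero_mem _, fun _ _ _ => rfl⟩
  smul_mem' := fun c _ hx => ⟨Submodule.smul_mem _ c hx.1, fun i j h => by simp [hx.2 i j h]⟩

theorem collisionSubmodule_anti {C D : Setoid (Fin n)} (h : C ≤ D) :
    collisionSubmodule d m D ≤ collisionSubmodule d m C :=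
  fun _ hx => ⟨hx.1, fun i j hij => hx.2 i j (h hij)⟩

theorem collisionSubmodule_le_comSpace (C : Setoid (Fin n)) :
    collisionSubmodule d m C ≤ comSpace d m := fun _ hx => hx.1

/-- The collision subspace of `C` in the Euclidean realization of the mass metric. -/
noncomputable def massCollision (d : ℕ) (C : Setoid (Fin n)) : Submodule ℝ (MassSpace n d) :=
  (collisionSubmodule d m C).map (massEquiv d hm).toLinearMap

theorem massEquiv_mem_massCollision {C : Setoid (Fin n)} {x : Config n d} :
    massEquiv d hm x ∈ massCollision hm d C ↔ x ∈ collisionSubspace m C := by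
  constructor
  · rintro ⟨y, hy, hxy⟩
    exact (massEquiv d hm).injective hxy ▸ hy
  · exact fun h => ⟨x, h, rfl⟩

theorem starProjection_massCollision (C : Setoid (Fin n)) {x : Config n d}
    (hx : x ∈ comSpace d m) :
    (massCollision hm d C).starProjection (massEquiv d hm x) =
      massEquiv d hm (extProj m C x) := by
  refine Submodule.eq_starProjection_of_mem_of_inner_eq_zero ?_ ?_
  · rw [massEquiv_mem_massCollision]
    refine ⟨?_, fun i j h => extProj_apply_eq_of_rel m h x⟩
    change ∑ k, m k • extProj m C x k = 0
    rw [sum_mass_smul_extProj hm]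
    exact hx
  · rintro _ ⟨y, hy, rfl⟩
    rw [inner_sub_left]
    change inner ℝ (massEquiv d hm x) (massEquiv d hm y) -
      inner ℝ (massEquiv d hm (extProj m C x)) (massEquiv d hm y) = 0
    rw [inner_massEquiv, inner_massEquiv, sum_mass_inner_extProj hm x hy.2, sub_self]

theorem massCollision_anti {C D : Setoid (Fin n)} (h : C ≤ D) :
    massCollision hm d D ≤ massCollision hm d C :=
  Submodule.map_mono (collisionSubmodule_anti h)

theorem exists_euclNorm_sq_le : ∃ c : ℝ, 0 ≤ c ∧ ∀ x : Config n d,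
    euclNorm x ^ 2 ≤ c * ‖massEquiv d hm x‖ ^ 2 := by
  refine ⟨∑ i, (m i)⁻¹, Finset.sum_nonneg fun i _ => (inv_pos.2 (hm i)).le, fun x => ?_⟩
  rw [euclNorm, Real.sq_sqrt (Finset.sum_nonneg fun i _ => sq_nonneg _),
    ← real_inner_self_eq_norm_sq, inner_massEquiv, Finset.sum_mul]
  refine Finset.sum_le_sum fun i _ => ?_
  rw [Finset.mul_sum]
  have h : ∀ j ∈ Finset.univ, 0 ≤ (m i)⁻¹ * (m j * inner ℝ (x j) (x j)) := fun j _ =>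
    mul_nonneg (inv_pos.2 (hm i)).le (mul_nonneg (hm j).le real_inner_self_nonneg)
  refine le_trans (le_of_eq ?_) (Finset.single_le_sum h (Finset.mem_univ i))
  rw [← mul_assoc, inv_mul_cancel₀ (hm i).ne', one_mul, real_inner_self_eq_norm_sq]

end MassMetric

/-! ### Curves made of straight pieces are trajectories -/

theorem eventually_collisionSet_le (x : Config n d) :
    ∀ᶠ y in 𝓝 x, collisionSet y ≤ collisionSet x := by
  have h : ∀ i j, ∀ᶠ y in 𝓝 x, y i = y j → x i = x j := by
    intro i j
    by_cases hij : x i = x j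
    · exact Eventually.of_forall fun _ _ => hij
    · have : ∀ᶠ y in 𝓝 x, y i ≠ y j :=
        (isOpen_ne_fun (continuous_apply i) (continuous_apply j)).mem_nhds hij
      filter_upwards [this] with y hy h
      exact absurd h hy
  filter_upwards [eventually_all.2 fun i => eventually_all.2 (h i)] with y hy i j hij
  exact hy i j hij

/-- Near `τ`, the curve `p` consists of two straight pieces, and its kink at `τ` preserves the
momenta of the clusters at time `τ`. -/
def IsAdmissibleKink (m : Fin n → ℝ) (p : ℝ → Config n d) (τ : ℝ) : Prop :=
  ∃ δ > 0, ∃ v w : Config n d, (∀ t, τ - δ ≤ t → t ≤ τ → p t = p τ + (t - τ) • v) ∧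
    (∀ t, τ ≤ t → t ≤ τ + δ → p t = p τ + (t - τ) • w) ∧
    extProj m (collisionSet (p τ)) v = extProj m (collisionSet (p τ)) w

theorem isOpen_openInterval (a b : EReal) : IsOpen (openInterval a b) :=
  (isOpen_lt continuous_const continuous_coe_real_ereal).inter
    (isOpen_lt continuous_coe_real_ereal continuous_const)

theorem hasDerivAt_affine (x v : Config n d) (τ t : ℝ) :
    HasDerivAt (fun s : ℝ => x + (s - τ) • v) v t := by
  simpa using (((hasDerivAt_id t).sub_const τ).smul_const v).const_add x

namespace IsAdmissibleKink

variable {m : Fin n → ℝ} {p : ℝ → Config n d} {τ : ℝ}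

theorem continuousAt (h : IsAdmissibleKink m p τ) : ContinuousAt p τ := by
  obtain ⟨δ, hδ, v, w, hv, hw, -⟩ := h
  have hc : ∀ v : Config n d, ContinuousAt (fun s : ℝ => p τ + (s - τ) • v) τ := fun v =>
    (hasDerivAt_affine _ v τ τ).continuousAt
  rw [continuousAt_iff_continuous_left_right]
  constructor
  · refine (hc v).continuousWithinAt.congr_of_eventuallyEq ?_ (by simp)
    filter_upwards [self_mem_nhdsWithin, mem_nhdsWithin_of_mem_nhds
      (Ici_mem_nhds (by linarith : τ - δ < τ))] with t h1 h2
    exact hv t h2 h1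
  · refine (hc w).continuousWithinAt.congr_of_eventuallyEq ?_ (by simp)
    filter_upwards [self_mem_nhdsWithin, mem_nhdsWithin_of_mem_nhds
      (Iic_mem_nhds (by linarith : τ < τ + δ))] with t h1 h2
    exact hw t h1 h2

theorem exists_extProj_eq (h : IsAdmissibleKink m p τ) :
    ∃ v : Config n d, ∃ δ > 0, ∀ t ∈ Set.Ioo (τ - δ) (τ + δ),
      extProj m (collisionSet (p τ)) (p t) =
        extProj m (collisionSet (p τ)) (p τ) + (t - τ) • v := by
  obtain ⟨δ, hδ, v, w, hv, hw, hvw⟩ := h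
  refine ⟨extProj m (collisionSet (p τ)) v, δ, hδ, fun t ht => ?_⟩
  rcases le_total t τ with h | h
  · rw [hv t ht.1.le h, extProj_add, extProj_smul]
  · rw [hw t h ht.2.le, extProj_add, extProj_smul, hvw]

theorem external (h : IsAdmissibleKink m p τ) {U : Set ℝ} (hU : U ∈ 𝓝 τ) :
    ∃ a b : ℝ, a < τ ∧ τ < b ∧ Set.Ioo a b ⊆ U ∧
    ContDiffOn ℝ 1 (fun t => extProj m (collisionSet (p τ)) (p t)) (Set.Ioo a b) ∧
    ∀ᶠ t in 𝓝 τ,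
      massMul m (deriv (fun s => extProj m (collisionSet (p τ)) (p s)) t) =
        massMul m (deriv (fun s => extProj m (collisionSet (p τ)) (p s)) τ) := by
  obtain ⟨v, δ, hδ, hv⟩ := h.exists_extProj_eq
  obtain ⟨δ', hδ', hU'⟩ := Metric.mem_nhds_iff.1 hU
  rw [Real.ball_eq_Ioo] at hU'
  have hd : ∀ t ∈ Set.Ioo (τ - δ) (τ + δ),
      deriv (fun s => extProj m (collisionSet (p τ)) (p s)) t = v := by
    intro t ht
    refine HasDerivAt.deriv ((hasDerivAt_affine
      (extProj m (collisionSet (p τ)) (p τ)) v τ t).congr_of_eventuallyEq ?_)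
    filter_upwards [Ioo_mem_nhds ht.1 ht.2] with s hs
    exact hv s hs
  refine ⟨τ - min δ δ', τ + min δ δ', ?_, ?_, ?_, ?_, ?_⟩
  · linarith [lt_min hδ hδ']
  · linarith [lt_min hδ hδ']
  · refine (Set.Ioo_subset_Ioo ?_ ?_).trans hU' <;> linarith [min_le_right δ δ']
  · have hc : ContDiff ℝ 1 fun t : ℝ => extProj m (collisionSet (p τ)) (p τ) + (t - τ) • v := by
      fun_prop
    refine hc.contDiffOn.congr fun t ht => hv t ?_
    exact Set.Ioo_subset_Ioo (by linarith [min_le_left δ δ']) (by linarith [min_le_left δ δ']) ht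
  · filter_upwards [Ioo_mem_nhds (by linarith : τ - δ < τ) (by linarith : τ < τ + δ)] with t ht
    rw [hd t ht, hd τ ⟨by linarith, by linarith⟩]

/-- While the clusters do not change, the cluster projection fixes the curve, so the straight motion
of the barycenters is that of the curve itself. -/
theorem eventually_hasDerivAt (hm : ∀ i, 0 < m i) (h : IsAdmissibleKink m p τ)
    (hcs : ∀ᶠ s in 𝓝 τ, collisionSet (p s) = collisionSet (p τ)) :
    ∃ v : Config n d, ∀ᶠ t in 𝓝 τ, HasDerivAt p v t := by
  obtain ⟨v, δ, hδ, hv⟩ := h.exists_extProj_eq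
  have hev : ∀ᶠ t in 𝓝 τ, p t = p τ + (t - τ) • v := by
    filter_upwards [hcs, Ioo_mem_nhds (by linarith : τ - δ < τ) (by linarith : τ < τ + δ)]
      with t ht htδ
    have h1 := hv t htδ
    have h2 : ∀ i j, collisionSet (p τ) i j → p t i = p t j := fun i j hij => by
      rw [← ht] at hij
      exact hij
    rwa [extProj_eq_self hm h2, extProj_eq_self hm fun i j hij => hij] at h1
  refine ⟨v, ?_⟩
  filter_upwards [eventually_eventually_nhds.2 hev] with t ht
  exact (hasDerivAt_affine _ v τ t).congr_of_eventuallyEq ht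

/-- Particles at distinct positions stay apart near `τ`; particles at the same position separate at
once unless their velocities agree. -/
theorem eventually_nhdsNE_collisionSet (x w : Config n d) (τ : ℝ) :
    ∀ᶠ t in 𝓝[≠] τ, collisionSet (x + (t - τ) • w) = Setoid.ker fun i => (x i, w i) := by
  have h : ∀ i j, ∀ᶠ t in 𝓝[≠] τ, ((x + (t - τ) • w) i = (x + (t - τ) • w) j ↔
      x i = x j ∧ w i = w j) := by
    intro i j
    by_cases hij : x i = x j
    · filter_upwards [self_mem_nhdsWithin] with t ht
      have : t - τ ≠ 0 := sub_ne_zero.2 ht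
      simp [hij, this]
    · have hc : Continuous fun t : ℝ => x + (t - τ) • w := by fun_prop
      have : ∀ᶠ t in 𝓝 τ, (x + (t - τ) • w) i ≠ (x + (t - τ) • w) j :=
        (isOpen_ne_fun ((continuous_apply i).comp hc)
          ((continuous_apply j).comp hc)).mem_nhds (by simpa using hij)
      filter_upwards [mem_nhdsWithin_of_mem_nhds this] with t ht
      simp only [hij, false_and, iff_false]
      exact ht
  filter_upwards [eventually_all.2 fun i => eventually_all.2 (h i)] with t ht
  ext i j
  simp only [Setoid.ker_def, Prod.mk.injEq]
  exact ht i j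

theorem eventually_notMem_collisionTimes (h : IsAdmissibleKink m p τ) (I : Set ℝ) :
    ∀ᶠ t in 𝓝[≠] τ, t ∉ collisionTimes I p := by
  obtain ⟨δ, hδ, v, w, hv, hw, -⟩ := h
  have key : ∀ t D, (∀ᶠ s in 𝓝 t, collisionSet (p s) = D) → t ∉ collisionTimes I p := by
    intro t D ht hcon
    refine hcon.2 (eventually_nhdsWithin_of_eventually_nhds ?_)
    filter_upwards [ht] with s hs
    rw [hs, ht.self_of_nhds]
  have hl : ∀ᶠ t in 𝓝[<] τ, collisionSet (p t) = Setoid.ker fun i => (p τ i, v i) := by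
    filter_upwards [nhdsWithin_mono τ (fun t ht => ne_of_lt ht)
      (eventually_nhdsNE_collisionSet (p τ) v τ), self_mem_nhdsWithin,
      mem_nhdsWithin_of_mem_nhds (Ici_mem_nhds (by linarith : τ - δ < τ))] with t h1 h2 h3
    rwa [hv t h3 (le_of_lt h2)]
  have hr : ∀ᶠ t in 𝓝[>] τ, collisionSet (p t) = Setoid.ker fun i => (p τ i, w i) := by
    filter_upwards [nhdsWithin_mono τ (fun t ht => ne_of_gt ht)
      (eventually_nhdsNE_collisionSet (p τ) w τ), self_mem_nhdsWithin,
      mem_nhdsWithin_of_mem_nhds (Iic_mem_nhds (by linarith : τ < τ + δ))] with t h1 h2 h3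
    rwa [hw t (le_of_lt h2) h3]
  rw [← Set.Iio_union_Ioi, nhdsWithin_union, eventually_sup]
  constructor
  · filter_upwards [eventually_eventually_nhdsWithin.2 hl, self_mem_nhdsWithin] with t h1 h2
    rw [IsOpen.nhdsWithin_eq isOpen_Iio h2] at h1
    exact key t _ h1
  · filter_upwards [eventually_eventually_nhdsWithin.2 hr, self_mem_nhdsWithin] with t h1 h2
    rw [IsOpen.nhdsWithin_eq isOpen_Ioi h2] at h1
    exact key t _ h1

end IsAdmissibleKink

theorem finite_collisionTimes_inter {m : Fin n → ℝ} {p : ℝ → Config n d} {I K : Set ℝ}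
    (hK : IsCompact K) (h : ∀ τ ∈ K, IsAdmissibleKink m p τ) :
    (collisionTimes I p ∩ K).Finite := by
  by_contra hinf
  obtain ⟨x, hx, hacc⟩ := Set.Infinite.exists_accPt_of_subset_isCompact hinf hK
    Set.inter_subset_right
  rw [accPt_iff_frequently_nhdsNE] at hacc
  exact hacc ((h x hx).eventually_notMem_collisionTimes I |>.mono fun t ht h' => ht h'.1)

theorem isTrajectory_of_isAdmissibleKink {m : Fin n → ℝ} (hm : ∀ i, 0 < m i) {T : EReal}
    (hT : 0 < T) {p : ℝ → Config n d} (hmem : ∀ t : ℝ, (t : EReal) < T → p t ∈ comSpace d m)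
    (hkink : ∀ t : ℝ, (t : EReal) < T → IsAdmissibleKink m p t)
    (hlim : ∀ b : ℝ, T = (b : EReal) → ¬ ∃ x ∈ comSpace d m, Tendsto p (𝓝[<] b) (𝓝 x)) :
    IsTrajectory m ⊥ T p where
  Tm_neg := EReal.bot_lt_zero
  Tp_pos := hT
  mem t ht := hmem t ht.2
  continuousOn t ht := (hkink t ht.2).continuousAt.continuousWithinAt
  no_limit_Tm a ha := absurd ha (EReal.bot_ne_coe a)
  no_limit_Tp := hlim
  momentum_const J hJ hJI := by
    have hloc : ∀ t ∈ J, ∃ v : Config n d, ∀ᶠ s in 𝓝 t, HasDerivAt p v s := by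
      intro t ht
      obtain ⟨h1, h2⟩ := hJI ht
      refine (hkink t h1.2).eventually_hasDerivAt hm ?_
      by_contra h3
      refine h2 ⟨h1, fun h4 => h3 ?_⟩
      rwa [(isOpen_openInterval _ _).nhdsWithin_eq h1] at h4
    have hconst : ∀ t ∈ J, ∀ s ∈ J, deriv p t = deriv p s := fun t ht s hs =>
      hJ.isPreconnected.induction₂ (fun t s => deriv p t = deriv p s) (fun t ht => by
        obtain ⟨v, hv⟩ := hloc t ht
        refine eventually_nhdsWithin_of_eventually_nhds ?_
        filter_upwards [hv] with s hs
        rw [hs.deriv, hv.self_of_nhds.deriv]) (fun _ _ _ _ _ _ => Eq.trans)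
        (fun _ _ _ _ => Eq.symm) ht hs
    rcases J.eq_empty_or_nonempty with rfl | ⟨t₀, ht₀⟩
    · exact ⟨0, fun t ht => ht.elim⟩
    · refine ⟨massMul m (deriv p t₀), fun t ht => ⟨deriv p t, ?_, by rw [hconst t ht t₀ ht₀]⟩⟩
      obtain ⟨v, hv⟩ := hloc t ht
      exact hv.self_of_nhds.differentiableAt.hasDerivAt
  external τ hτ := (hkink τ hτ.2).external ((isOpen_openInterval _ _).mem_nhds hτ)

/-! ### From equilibria to trajectories -/

theorem IsNetwork.starProjection {E : Type*} [NormedAddCommGroup E] [InnerProductSpace ℝ E]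
    [FiniteDimensional ℝ E] {S : Set ℝ} {V : ℝ → Submodule ℝ E} {B : ℝ} {u : ℝ → E}
    (hu : IsNetwork S V B u) {W : Submodule ℝ E} (hW : ∀ t, V t ≤ W) :
    IsNetwork S V B fun t => W.starProjection (u t) := by
  refine ⟨fun σ hσ h0 h1 => ?_, fun s x t h0 h1 h2 h3 v hv => ?_⟩
  · rw [Submodule.starProjection_eq_self_iff.2 (hW σ (hu.mem σ hσ h0 h1))]
    exact hu.mem σ hσ h0 h1
  · simp only [Submodule.inner_starProjection_left_eq_right]
    refine hu.chord s x t h0 h1 h2 h3 _ fun σ hσ h4 h5 => ?_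
    rw [Submodule.starProjection_eq_self_iff.2 (hW σ (hv σ hσ h4 h5))]
    exact hv σ hσ h4 h5

theorem massMul_injective {m : Fin n → ℝ} (hm : ∀ i, 0 < m i) :
    Function.Injective (massMul (d := d) m) := by
  intro x y h
  funext i
  exact smul_right_injective _ (hm i).ne' (congrFun h i)

/-- The clusters of a trajectory at time `τ` are preserved or refined near `τ`, and their
barycenters move along straight lines. -/
theorem IsTrajectory.exists_chord {m : Fin n → ℝ} (hm : ∀ i, 0 < m i) {Tm Tp : EReal}
    {r : ℝ → Config n d} (hr : IsTrajectory m Tm Tp r) {τ : ℝ} (hτ : τ ∈ openInterval Tm Tp) :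
    ∃ δ > 0, (∀ s, τ - δ < s → s < τ + δ → s ∈ openInterval Tm Tp ∧
        collisionSet (r s) ≤ collisionSet (r τ)) ∧
      ∀ s x t, τ - δ < s → s ≤ x → x ≤ t → t < τ + δ →
        (t - s) • extProj m (collisionSet (r τ)) (r x) =
          (t - x) • extProj m (collisionSet (r τ)) (r s) +
            (x - s) • extProj m (collisionSet (r τ)) (r t) := by
  obtain ⟨a, b, ha, hb, hab, hcd, hmom⟩ := hr.external τ hτ
  set g : ℝ → Config n d := fun t => extProj m (collisionSet (r τ)) (r t) with hg
  have hnear : ∀ᶠ s in 𝓝 τ, s ∈ openInterval Tm Tp ∧ collisionSet (r s) ≤ collisionSet (r τ) ∧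
      HasDerivAt g (deriv g τ) s := by
    have hU := (isOpen_openInterval Tm Tp).mem_nhds hτ
    filter_upwards [hU, (hr.continuousOn.continuousAt hU).eventually
      (eventually_collisionSet_le (r τ)), hmom, Ioo_mem_nhds ha hb] with s h1 h2 h3 h4
    refine ⟨h1, h2, ?_⟩
    rw [← massMul_injective hm h3]
    exact ((hcd.differentiableOn one_ne_zero).differentiableAt
      (Ioo_mem_nhds h4.1 h4.2)).hasDerivAt
  obtain ⟨δ, hδ, h⟩ := Metric.eventually_nhds_iff_ball.1 hnear
  rw [Real.ball_eq_Ioo] at h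
  refine ⟨δ, hδ, fun s h1 h2 => ⟨(h s ⟨h1, h2⟩).1, (h s ⟨h1, h2⟩).2.1⟩,
    fun s x t h1 h2 h3 h4 => ?_⟩
  have haff : ∀ t ∈ Set.Ioo (τ - δ) (τ + δ), g t = g τ + (t - τ) • deriv g τ := by
    intro t ht
    have hd : ∀ s ∈ Set.Ioo (τ - δ) (τ + δ),
        HasDerivAt (fun s => g s - (g τ + (s - τ) • deriv g τ)) 0 s := by
      intro s hs
      have := (h s hs).2.2.fun_sub (hasDerivAt_affine (g τ) (deriv g τ) τ s)
      rwa [sub_self] at this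
    have := isOpen_Ioo.is_const_of_deriv_eq_zero (isPreconnected_Ioo)
      (fun s hs => (hd s hs).differentiableAt.differentiableWithinAt)
      (fun s hs => (hd s hs).deriv) ht
      (⟨by linarith, by linarith⟩ : τ ∈ Set.Ioo (τ - δ) (τ + δ))
    simpa [sub_eq_zero] using this
  change (t - s) • g x = (t - x) • g s + (x - s) • g t
  rw [haff s ⟨h1, by linarith⟩, haff x ⟨by linarith, by linarith⟩, haff t ⟨by linarith, h4⟩]
  module

/-- Any positive, strictly concave function `ψ` is the square of an approximation error that can
be achieved by a trajectory made of finitely many straight pieces on each compact set. -/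
theorem exists_isTrajectory_near {m : Fin n → ℝ} (hm : ∀ i, 0 < m i) {Tm T : EReal}
    {r : ℝ → Config n d} (hr : IsTrajectory m Tm T r) {b : ℕ → ℝ} {ψ : ℝ → ℝ}
    (hb : StrictMono b) (hb0 : b 0 = 0) (hbT : ∀ t : ℝ, (t : EReal) < T ↔ ∃ N, t < b N)
    (hψ : Continuous ψ) (hconc : ∀ t δ, 0 < δ → ψ (t - δ) + ψ (t + δ) < 2 * ψ t)
    (hpos : ∀ t : ℝ, 0 ≤ t → (t : EReal) < T → 0 < ψ t)
    (hlim : ∀ x : ℝ, T = (x : EReal) → Tendsto ψ (𝓝[<] x) (𝓝 0)) :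
    ∃ p : ℝ → Config n d, IsTrajectory m ⊥ T p ∧
      (∀ τ : ℝ, (τ : EReal) < T → IsAdmissibleKink m p τ) ∧
      ∀ t : ℝ, 0 ≤ t → (t : EReal) < T → ‖massEquiv d hm (p t - r t)‖ ^ 2 ≤ ψ t := by
  have hdom : ∀ t : ℝ, 0 ≤ t → (∃ N, t < b N) → t ∈ openInterval Tm T := fun t h0 h1 =>
    ⟨hr.Tm_neg.trans_le (by exact_mod_cast h0), (hbT t).2 h1⟩
  set Φ := massEquiv d hm with hΦ
  set V : ℝ → Submodule ℝ (MassSpace n d) := fun t => massCollision hm d (collisionSet (r t))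
    with hV
  obtain ⟨S, u₀, hS, hu₀, hu₀0, hu₀near⟩ := exists_isNetwork_near (V := V)
    (q := fun t => Φ (r t)) (ψ := ψ) hb hb0
    (fun t h0 h1 => (continuous_massEquiv hm).continuousAt.comp
      (hr.continuousOn.continuousAt ((isOpen_openInterval _ _).mem_nhds (hdom t h0 h1))))
    (fun t h0 h1 => (massEquiv_mem_massCollision hm).2 ⟨hr.mem t (hdom t h0 h1), fun _ _ h => h⟩)
    (fun τ h0 h1 => by
      obtain ⟨δ, hδ, h2, h3⟩ := hr.exists_chord hm (hdom τ h0 h1)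
      refine ⟨δ, hδ, fun s h4 h5 => massCollision_anti hm (h2 s h4 h5).2,
        fun s x t h4 h5 h6 h7 => ?_⟩
      rw [starProjection_massCollision hm _ (hr.mem x (h2 x (by linarith) (by linarith)).1),
        starProjection_massCollision hm _ (hr.mem s (h2 s (by linarith) (by linarith)).1),
        starProjection_massCollision hm _ (hr.mem t (h2 t (by linarith) (by linarith)).1),
        ← map_smul, h3 s x t h4 h5 h6 h7, map_add, map_smul, map_smul])
    hψ hconc (fun t h0 h1 => hpos t h0 ((hbT t).2 h1))
  set W : Submodule ℝ (MassSpace n d) := (comSpace d m).map Φ.toLinearMap with hW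
  have hVW : ∀ t, V t ≤ W := fun t => Submodule.map_mono (collisionSubmodule_le_comSpace _)
  -- The kinks of `u₀` may leave the center of mass space. Projecting back keeps the equilibrium, as
  -- every `V t` lies in `W`, and does not increase the distance to the trajectory, which lies in
  -- `W`.
  set u : ℝ → MassSpace n d := fun t => W.starProjection (u₀ t) with hu_def
  have hu : ∀ N, IsNetwork S V (b N) u := fun N => (hu₀ N).starProjection hVW
  have hrW : ∀ t : ℝ, 0 ≤ t → (t : EReal) < T → Φ (r t) ∈ W := fun t h0 h1 =>
    ⟨r t, hr.mem t (hdom t h0 ((hbT t).1 h1)), rfl⟩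
  have hunear : ∀ t : ℝ, 0 ≤ t → (t : EReal) < T → ‖u t - Φ (r t)‖ ^ 2 ≤ ψ t := by
    intro t h0 h1
    refine le_trans ?_ (hu₀near t h0 ((hbT t).1 h1))
    refine pow_le_pow_left₀ (norm_nonneg _) ?_ 2
    rw [← Submodule.starProjection_eq_self_iff.2 (hrW t h0 h1), hu_def, ← map_sub,
      Submodule.starProjection_eq_self_iff.2 (hrW t h0 h1)]
    exact Submodule.norm_starProjection_apply_le _ _
  have hmemcom : ∀ t, Φ.symm (u t) ∈ comSpace d m := by
    intro t
    obtain ⟨x, hx, hxu⟩ : u t ∈ W := W.starProjection_apply_mem _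
    rw [← hxu]
    change Φ.symm (Φ x) ∈ _
    rwa [LinearEquiv.symm_apply_apply]
  have hseg : ∀ (N : ℕ) (s t : ℝ), 0 ≤ s → s < t → t ≤ b N → (∀ σ ∈ S, s < σ → ¬ σ < t) →
      ∀ x, s ≤ x → x ≤ t → (t - s) • Φ.symm (u x) =
        (t - x) • Φ.symm (u s) + (x - s) • Φ.symm (u t) := by
    intro N s t h0 h1 h2 h3 x h4 h5
    simp only [← map_smul, ← map_add]
    congr 1
    refine ext_inner_right ℝ fun v => ?_
    simpa only [inner_add_left, real_inner_smul_left] using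
      (hu N).chord s x t h0 h4 h5 h2 v fun σ hσ h6 h7 => (h3 σ hσ h6 h7).elim
  have hT0 : ∃ N, 0 < b N := (hbT 0).1 hr.Tp_pos
  obtain ⟨t₁, ht₁, h01⟩ : ∃ t₁ > 0, ∀ x, 0 ≤ x → x ≤ t₁ → t₁ • Φ.symm (u x) =
      (t₁ - x) • Φ.symm (u 0) + x • Φ.symm (u t₁) := by
    obtain ⟨δ, hδ, h⟩ := hS 0 le_rfl hT0
    obtain ⟨N, hN⟩ := hT0
    obtain ⟨t₁, h1, h2⟩ := exists_between (lt_min hδ hN)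
    rw [lt_min_iff] at h2
    refine ⟨t₁, h1, fun x hx0 hx1 => ?_⟩
    have := hseg N 0 t₁ le_rfl h1 h2.2.le (fun σ hσ h3 h4 => by
      have := h σ hσ (by rw [sub_zero, abs_of_pos h3]; linarith)
      linarith) x hx0 hx1
    simpa using this
  -- No time in `S` lies strictly between `0` and `t₁`, so the initial segment is straight;
  -- prolonging it to all negative times gives the lower escape time `⊥`.
  set v₁ : Config n d := t₁⁻¹ • (Φ.symm (u t₁) - Φ.symm (u 0)) with hv₁
  set p : ℝ → Config n d := fun t => if 0 ≤ t then Φ.symm (u t) else Φ.symm (u 0) + t • v₁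
    with hp
  have hp_nonneg : ∀ t, 0 ≤ t → p t = Φ.symm (u t) := fun t ht => if_pos ht
  have hp_le : ∀ t, t ≤ t₁ → p t = Φ.symm (u 0) + t • v₁ := by
    intro t ht
    by_cases h0 : 0 ≤ t
    · rw [hp_nonneg t h0]
      refine smul_right_injective _ ht₁.ne' ?_
      simp only [h01 t h0 ht, hv₁, smul_add, smul_comm t₁ t, smul_inv_smul₀ ht₁.ne']
      module
    · exact if_neg h0
  have hv₁com : v₁ ∈ comSpace d m :=
    Submodule.smul_mem _ _ (Submodule.sub_mem _ (hmemcom _) (hmemcom _))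
  have hpcom : ∀ t, p t ∈ comSpace d m := by
    intro t
    by_cases h0 : 0 ≤ t
    · exact hp_nonneg t h0 ▸ hmemcom t
    · rw [hp_le t (by linarith)]
      exact Submodule.add_mem _ (hmemcom _) (Submodule.smul_mem _ _ hv₁com)
  have hkink : ∀ τ : ℝ, (τ : EReal) < T → IsAdmissibleKink m p τ := by
    intro τ hτ
    rcases le_or_gt τ 0 with h0 | h0
    · refine ⟨t₁, ht₁, v₁, v₁, fun t _ h2 => ?_, fun t _ h2 => ?_, rfl⟩ <;>
      · rw [hp_le t (by linarith), hp_le τ (by linarith)]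
        module
    have hτ' := (hbT τ).1 hτ
    obtain ⟨ε, hε, hεS⟩ := hS τ h0.le hτ'
    obtain ⟨N, hN⟩ := hτ'
    obtain ⟨δ, hδ, hδ'⟩ := exists_between (lt_min hε (lt_min h0 (sub_pos.2 hN)))
    simp only [lt_min_iff] at hδ'
    obtain ⟨hδε, hδτ, hδN⟩ := hδ'
    have hSτ : ∀ σ ∈ S, τ - δ < σ → σ < τ + δ → σ = τ := fun σ hσ h1 h2 =>
      hεS σ hσ (abs_lt.2 ⟨by linarith, by linarith⟩)
    set v := δ⁻¹ • (p τ - p (τ - δ)) with hv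
    set w := δ⁻¹ • (p (τ + δ) - p τ) with hw
    have hvcom : v ∈ comSpace d m := Submodule.smul_mem _ _ (Submodule.sub_mem _ (hpcom _) (hpcom _))
    have hwcom : w ∈ comSpace d m := Submodule.smul_mem _ _ (Submodule.sub_mem _ (hpcom _) (hpcom _))
    refine ⟨δ, hδ, v, w, fun t h1 h2 => ?_, fun t h1 h2 => ?_, ?_⟩
    · have := hseg N (τ - δ) τ (by linarith) (by linarith) hN.le
        (fun σ hσ h3 h4 => by linarith [hSτ σ hσ h3 (by linarith)]) t h1 h2
      rw [← hp_nonneg t (by linarith), ← hp_nonneg τ h0.le, ← hp_nonneg (τ - δ) (by linarith),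
        sub_sub_cancel] at this
      refine smul_right_injective _ hδ.ne' ?_
      simp only [this, hv, smul_add, smul_comm δ (t - τ), smul_inv_smul₀ hδ.ne']
      module
    · have := hseg N τ (τ + δ) h0.le (by linarith) (by linarith)
        (fun σ hσ h3 h4 => by linarith [hSτ σ hσ (by linarith) h4]) t h1 h2
      rw [← hp_nonneg t (by linarith), ← hp_nonneg τ h0.le, ← hp_nonneg (τ + δ) (by linarith),
        add_sub_cancel_left] at this
      refine smul_right_injective _ hδ.ne' ?_
      simp only [this, hw, smul_add, smul_comm δ (t - τ), smul_inv_smul₀ hδ.ne']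
      module
    -- If `τ ∈ S`, then `p τ` respects the clusters of `r τ`, so the collision subspace of `D` lies
    -- in `V τ` and the kink is orthogonal to it. Otherwise there is no kink.
    · set D := collisionSet (p τ) with hD
      refine Φ.injective ?_
      rw [← starProjection_massCollision hm D hvcom, ← starProjection_massCollision hm D hwcom]
      refine ext_inner_right ℝ fun y => ?_
      rw [Submodule.inner_starProjection_left_eq_right,
        Submodule.inner_starProjection_left_eq_right]
      have hy := (massCollision hm d D).starProjection_apply_mem y
      set z := (massCollision hm d D).starProjection y
      have hch := (hu N).chord (τ - δ) τ (τ + δ) (by linarith) (by linarith) (by linarith)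
        (by linarith) z (fun σ hσ h1 h2 => by
          have h3 := hSτ σ hσ h1 h2
          subst h3
          have h4 := (hu N).mem σ hσ h0.le hN.le
          have h5 : Φ (p σ) ∈ V σ := by rwa [hp_nonneg σ h0.le, LinearEquiv.apply_symm_apply]
          refine massCollision_anti hm (fun {i j} hij => ?_) hy
          exact ((massEquiv_mem_massCollision hm).1 h5).2 i j hij)
      have hΦp : ∀ t, 0 ≤ t → u t = Φ (p t) := fun t ht => by
        rw [hp_nonneg t ht, LinearEquiv.apply_symm_apply]
      rw [hΦp τ h0.le, hΦp (τ - δ) (by linarith), hΦp (τ + δ) (by linarith)] at hch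
      simp only [hv, hw, map_smul, map_sub, real_inner_smul_left, inner_sub_left]
      congr 1
      refine mul_left_cancel₀ hδ.ne' ?_
      linear_combination hch
  have hnear : ∀ t : ℝ, 0 ≤ t → (t : EReal) < T → ‖Φ (p t - r t)‖ ^ 2 ≤ ψ t := by
    intro t h0 h1
    rw [map_sub, hp_nonneg t h0, LinearEquiv.apply_symm_apply]
    exact hunear t h0 h1
  refine ⟨p, isTrajectory_of_isAdmissibleKink hm hr.Tp_pos (fun t _ => hpcom t) hkink ?_, hkink,
    hnear⟩
  rintro x hTx ⟨y, hy, hpy⟩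
  refine hr.no_limit_Tp x hTx ⟨y, hy, ?_⟩
  have hx0 : 0 < x := by
    have := hr.Tp_pos
    rw [hTx] at this
    exact_mod_cast this
  have hdiff : Tendsto (fun t => Φ (p t - r t)) (𝓝[<] x) (𝓝 0) := by
    rw [tendsto_zero_iff_norm_tendsto_zero]
    have hs : Tendsto (fun t => √(ψ t)) (𝓝[<] x) (𝓝 0) := by
      simpa [Function.comp_def] using (Real.continuous_sqrt.tendsto 0).comp (hlim x hTx)
    refine squeeze_zero' (Eventually.of_forall fun _ => norm_nonneg _) ?_ hs
    filter_upwards [self_mem_nhdsWithin, mem_nhdsWithin_of_mem_nhds (Ici_mem_nhds hx0)]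
      with t h1 h2
    refine Real.le_sqrt_of_sq_le (hnear t h2 ?_)
    rw [hTx]
    exact_mod_cast h1
  have hdiff' : Tendsto (fun t => p t - r t) (𝓝[<] x) (𝓝 0) := by
    have := ((continuous_massEquiv_symm hm).tendsto (0 : MassSpace n d)).comp hdiff
    simpa [Function.comp_def, hΦ] using this
  simpa using hpy.sub hdiff'

/-! ### Exhaustion of the time interval and the concave weight -/

theorem exists_time_scale {T : EReal} (hT : 0 < T) :
    ∃ (b : ℕ → ℝ) (φ : ℝ → ℝ) (M : ℝ), StrictMono b ∧ b 0 = 0 ∧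
      (∀ t : ℝ, (t : EReal) < T ↔ ∃ N, t < b N) ∧ Continuous φ ∧
      (∀ t δ, 0 < δ → φ (t - δ) + φ (t + δ) < 2 * φ t) ∧
      (∀ t : ℝ, 0 ≤ t → (t : EReal) < T → 0 < φ t ∧ φ t ≤ M) ∧
      ∀ x : ℝ, T = (x : EReal) → Tendsto φ (𝓝[<] x) (𝓝 0) := by
  induction T with
  | bot => exact absurd hT (not_lt.2 bot_le)
  | top =>
    refine ⟨fun N => N, fun t => 2 - Real.exp (-t), 2, Nat.strictMono_cast, Nat.cast_zero,
      fun t => ⟨fun _ => exists_nat_gt t, fun _ => EReal.coe_lt_top t⟩, by fun_prop,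
      fun t δ hδ => ?_, fun t h0 _ => ⟨?_, ?_⟩, fun x hx => absurd hx (EReal.coe_ne_top x).symm⟩
    · have h1 : Real.exp (-(t - δ)) = Real.exp (-t) * Real.exp δ := by
        rw [← Real.exp_add]; ring_nf
      have h2 : Real.exp (-(t + δ)) = Real.exp (-t) * Real.exp (-δ) := by
        rw [← Real.exp_add]; ring_nf
      have h3 := Real.add_one_lt_exp hδ.ne'
      have h4 := Real.add_one_lt_exp (neg_ne_zero.2 hδ.ne')
      have h5 := mul_lt_mul_of_pos_left (add_lt_add h3 h4) (Real.exp_pos (-t))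
      simp only [h1, h2]
      linarith
    · have := Real.exp_le_one_iff.2 (neg_nonpos.2 h0)
      linarith
    · have := Real.exp_pos (-t)
      linarith
  | coe x =>
    have hx : 0 < x := by exact_mod_cast hT
    -- For finite `T` the weight must vanish at `T`; for `T = ⊤` it only has to be bounded and stay
    -- positive, as `2 - exp (-t)` does.
    refine ⟨fun N => x - x / (N + 1), fun t => x ^ 2 - t ^ 2, x ^ 2, ?_, by simp, fun t => ?_,
      by fun_prop, fun t δ hδ => by nlinarith [sq_pos_of_pos hδ], fun t h0 h1 => ⟨?_, ?_⟩,
      fun y hy => ?_⟩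
    · refine strictMono_nat_of_lt_succ fun N => ?_
      refine sub_lt_sub_left (div_lt_div_of_pos_left hx (by positivity) ?_) _
      push_cast
      linarith
    · rw [EReal.coe_lt_coe_iff]
      constructor
      · intro h
        obtain ⟨N, hN⟩ := exists_nat_one_div_lt (div_pos (sub_pos.2 h) hx)
        refine ⟨N, ?_⟩
        rw [lt_div_iff₀ hx] at hN
        have : x / ((N : ℝ) + 1) = 1 / ((N : ℝ) + 1) * x := by ring
        linarith
      · rintro ⟨N, hN⟩
        have : 0 < x / ((N : ℝ) + 1) := by positivity
        linarith
    · have h2 : t < x := by exact_mod_cast h1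
      nlinarith
    · nlinarith [sq_nonneg t]
    · have hxy : x = y := by exact_mod_cast hy
      subst hxy
      have hc : Continuous fun t : ℝ => x ^ 2 - t ^ 2 := by fun_prop
      have := hc.tendsto x
      rw [sub_self] at this
      exact this.mono_left nhdsWithin_le_nhds

end NDParticles

theorem proposition3p25 (n d : ℕ) (m : Fin n → ℝ) (hm : ∀ i, 0 < m i)
    (T : EReal) (q : ℝ → NDParticles.Config n d)
    (hq : NDParticles.IsForwardTrajectory m T q) :
    ∃ qε : ℝ → ℝ → NDParticles.Config n d,
      (∀ ε : ℝ, 0 < ε → NDParticles.IsForwardTrajectory m T (qε ε)) ∧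
      (∀ K : Set ℝ, IsCompact K → K ⊆ NDParticles.forwardInterval T →
        Tendsto (fun ε : ℝ => sSup ((fun t : ℝ => NDParticles.euclNorm (qε ε t - q t)) '' K)) (𝓝[>] 0) (𝓝 0)) ∧
      (∀ ε : ℝ, 0 < ε → ∀ K : Set ℝ, IsCompact K → K ⊆ NDParticles.forwardInterval T →
        (NDParticles.collisionTimes (NDParticles.forwardInterval T) (qε ε) ∩ K).Finite) := by
  obtain ⟨Tm, r, hr, hqr⟩ := hq
  obtain ⟨b, φ, M, hb, hb0, hbT, hφ, hconc, hφpos, hφlim⟩ :=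
    NDParticles.exists_time_scale hr.Tp_pos
  have key : ∀ ε : ℝ, 0 < ε → _ := fun ε hε =>
    NDParticles.exists_isTrajectory_near hm hr (ψ := fun t => ε * φ t) hb hb0 hbT (by fun_prop)
      (fun t δ hδ => by
        have := mul_lt_mul_of_pos_left (hconc t δ hδ) hε
        linarith)
      (fun t h0 h1 => mul_pos hε (hφpos t h0 h1).1)
      (fun x hx => by simpa using (hφlim x hx).const_mul ε)
  choose! p hp hkink hnear using key
  obtain ⟨c, hc0, hc⟩ := NDParticles.exists_euclNorm_sq_le (d := d) hm
  refine ⟨p, fun ε hε => ⟨⊥, p ε, hp ε hε, fun _ _ => rfl⟩, fun K _ hKT => ?_,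
    fun ε hε K hK hKT => NDParticles.finite_collisionTimes_inter hK fun τ hτ =>
      hkink ε hε τ (hKT hτ).2⟩
  -- `M` bounds the weight and `c` compares the Euclidean norm with the mass norm, so this rate is
  -- uniform in `K`.
  have hbound : Tendsto (fun ε : ℝ => √(c * (ε * M))) (𝓝[>] 0) (𝓝 0) := by
    have hcont : Continuous fun ε : ℝ => √(c * (ε * M)) := by fun_prop
    have := hcont.tendsto 0
    simp only [zero_mul, mul_zero, Real.sqrt_zero] at this
    exact this.mono_left nhdsWithin_le_nhds
  refine squeeze_zero' (Eventually.of_forall fun ε => ?_) ?_ hbound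
  · refine Real.sSup_nonneg ?_
    rintro _ ⟨t, _, rfl⟩
    exact Real.sqrt_nonneg _
  · filter_upwards [self_mem_nhdsWithin] with ε hε
    refine Real.sSup_le ?_ (Real.sqrt_nonneg _)
    rintro _ ⟨t, ht, rfl⟩
    obtain ⟨h0, h1⟩ := hKT ht
    refine Real.le_sqrt_of_sq_le ((hc _).trans (mul_le_mul_of_nonneg_left ?_ hc0))
    rw [hqr ⟨h0, h1⟩]
    exact (hnear ε hε t h0 h1).trans
      (mul_le_mul_of_nonneg_left (hφpos t h0 h1).2 (le_of_lt hε))
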